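/- Let $\mathbb{F}$ be a finite field, $m,N\ge 1$ integers, $n=mN<|\mathbb{F}|$, $\gamma\in\mathbb{F}$ an element of multiplicative order at least $n$, and $0\le k\le n$. The $m$-folded Reed–Solomon code $\mathcal{C}\subseteq(\mathbb{F}^m)^N$ of block length $N$ and rate $R=k/n$ consists of all words $\big((f(\gamma^{mi}),f(\gamma^{mi+1}),\dots,f(\gamma^{mi+m-1}))\big)_{0\le i<N}$ with $f\in\mathbb{F}[X]$ and $\deg f<k$. Let $\Delta$ be the normalized Hamming distance over the alphabet $\mathbb{F}^m$, and for $g\in(\mathbb{F}^m)^N$ let $\mathcal{L}(g,\eta)=\{h\in\mathcal{C}:\Delta(g,h)<\eta\}$. For an integer $s$ with $1\le s\le m$ put $\rho=\frac{s}{s+1}\left(1-\frac{mR}{m-s+1}\right)$. Algorithms are randomized algebraic computation trees: the input is $1$, $\gamma$ and the $mN$ entries of $g$. A tree accesses field elements only through the operations $+,-,\times,\div$ (with $x/0=0$) and equality tests. Each of these counts as one field operation, while control flow and uniform random choices are free. A tree may depend on $m,N,k,s$ and on other numerical parameters, but not on $\mathbb{F}$, $\gamma$ or $g$. Let $T$ denote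 the number of field operations required to compute, from any received word $g$, a basis $(h_0,h_1,\dots,h_d)$ of an affine subspace $\mathcal{H}=\{h_0+\sum_{i=1}^{d}\alpha_i h_i:\alpha_i\in\mathbb{F}\}\subseteq\mathcal{C}$ of dimension $d\le s-1$ (that is, $h_1,\dots,h_d$ are linearly independent) with $\mathcal{L}(g,\rho)\subseteq\mathcal{H}$. More precisely, $T$ is a bound on the number of field operations of any given algorithm $A$ that computes such a basis for every $g$ with certainty. **Theorem.** There is an absolute constant $C>0$ such that for all $m,N,k,s$ as above, every real $\beta$ with $0<\beta\le s$, and every algorithm $A$, there is a randomized algorithm $P$, depending only on $m,N,k,s,\beta,A$, with the following property. For all $\mathbb{F},\gamma$ as above and every integer $T\ge 0$ for which $A$ computes a basis as described within $T$ field operations for every received word, and for every $g\in(\mathbb{F}^m)^N$, the algorithm $P$ on input $g$ always performs at most $$T+C\,m\,s^5\,\log\!\left(\tfrac{s}{\beta}\right)N$$ field operations, and with probability at least $1-\beta$ it outputs exactly the list $\mathcal{L}(g,\rho)$. -/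

import Mathlib

open scoped BigOperators

/-! ### Folded Reed–Solomon codes -/

/-- Words of block length `N` over the alphabet `F ^ m`. -/
abbrev FWord (F : Type*) (m N : ℕ) : Type _ := Fin N → Fin m → F

/-- The folded encoding: the `j`-th entry of the `i`-th symbol is `f (γ ^ (m * i + j))`. -/
noncomputable def frsEncode {F : Type*} [Field F] (m N : ℕ) (γ : F) (f : Polynomial F) :
    FWord F m N :=
  fun i j => f.eval (γ ^ (m * (i : ℕ) + (j : ℕ)))

/-- The `m`-folded Reed–Solomon code of block length `N`: encodings of all polynomials of degree
less than `k`. Its rate is `frsRate m N k`, so that `k = R * n` with `n = m * N`. -/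
def frsCode {F : Type*} [Field F] (m N k : ℕ) (γ : F) : Set (FWord F m N) :=
  {w | ∃ f : Polynomial F, f.degree < (k : WithBot ℕ) ∧ frsEncode m N γ f = w}

/-- The rate `R = k / n`, where `n = m * N`. -/
noncomputable def frsRate (m N k : ℕ) : ℝ := (k : ℝ) / ((m : ℝ) * (N : ℝ))

/-- Normalized Hamming distance: the fraction of the `N` coordinates (symbols of `F ^ m`) on which
two words differ. -/
noncomputable def relDist {F : Type*} [DecidableEq F] {m N : ℕ} (g h : FWord F m N) : ℝ :=
  (hammingDist g h : ℝ) / (N : ℝ)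

/-- The list `L(g, η)` of the codewords at normalized distance less than `η` from `g`. -/
def frsList {F : Type*} [Field F] [DecidableEq F] {m N : ℕ} (k : ℕ) (γ : F) (g : FWord F m N)
    (η : ℝ) : Set (FWord F m N) :=
  {h | h ∈ frsCode m N k γ ∧ relDist g h < η}

/-- The decoding radius `(s / (s + 1)) * (1 - m R / (m - s + 1))`. -/
noncomputable def frsRadius (m N k s : ℕ) : ℝ :=
  (s : ℝ) / ((s : ℝ) + 1) * (1 - (m : ℝ) * frsRate m N k / ((m : ℝ) - (s : ℝ) + 1))

/-! ### Randomized algebraic computation trees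

The model in which field operations are counted. A computation keeps a tape of field elements, on
which the result of every field operation is appended. The tree itself mentions no field and no
field element: it refers to field elements only by their positions on the tape, so the only access
to the field is through arithmetic operations and equality tests, and each of them costs one unit.
Control flow and random choices are free. -/

/-- The arithmetic operations of a field. -/
inductive ArithOp
  | add
  | sub
  | mul
  | div

/-- Value of an arithmetic operation (with `x / 0 = 0`). -/
def ArithOp.eval {F : Type*} [Field F] : ArithOp → F → F → F
  | .add, x, y => x + y
  | .sub, x, y => x - y
  | .mul, x, y => x * y
  | .div, x, y => x / y

/-- Randomized algebraic computation trees with outputs in `α`. -/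
inductive CompTree (α : Type) : Type
  /-- stop with the given output -/
  | halt (out : α) : CompTree α
  /-- apply `o` to the elements at positions `a`, `b`, append the result to the tape, go on -/
  | op (o : ArithOp) (a b : ℕ) (next : CompTree α) : CompTree α
  /-- branch on whether the elements at positions `a`, `b` are equal -/
  | ifEq (a b : ℕ) (yes no : CompTree α) : CompTree α
  /-- draw `i` uniformly from `n + 1` values, independently of earlier draws, go on with branch
  `i` -/
  | rand (n : ℕ) (branch : Fin (n + 1) → CompTree α) : CompTree α

namespace CompTree

variable {α : Type} {F : Type*} [Field F] [DecidableEq F]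

/-- The largest number of field operations (arithmetic operations and equality tests) over all the
outcomes of the random choices, on the initial tape `σ`. Positions beyond the tape read as `0`. -/
def worstOps : CompTree α → List F → ℕ
  | halt _, _ => 0
  | op o a b next, σ => worstOps next (σ ++ [o.eval (σ.getD a 0) (σ.getD b 0)]) + 1
  | ifEq a b yes no, σ => (if σ.getD a 0 = σ.getD b 0 then worstOps yes σ else worstOps no σ) + 1
  | rand _ branch, σ => Finset.univ.sup fun i => worstOps (branch i) σ

/-- The distribution of the output together with the final tape, on the initial tape `σ`. -/
noncomputable def run : CompTree α → List F → PMF (α × List F)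
  | halt out, σ => PMF.pure (out, σ)
  | op o a b next, σ => run next (σ ++ [o.eval (σ.getD a 0) (σ.getD b 0)])
  | ifEq a b yes no, σ => if σ.getD a 0 = σ.getD b 0 then run yes σ else run no σ
  | rand n branch, σ => (PMF.uniformOfFintype (Fin (n + 1))).bind fun i => run (branch i) σ

end CompTree

/-- The input tape for the code with element `γ` and the received word `g`: first `1`, then `γ`,
then the `m * N` entries of `g`, symbol by symbol (the entry `g i j` is at position
`2 + (m * i + j)`). -/
def inputTape {F : Type*} [Field F] {m N : ℕ} (γ : F) (g : FWord F m N) : List F :=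
  1 :: γ :: (List.ofFn fun i : Fin N => List.ofFn fun j : Fin m => g i j).flatten

/-- A word given by the tape positions of its entries. -/
abbrev AddrWord (m N : ℕ) : Type := Fin N → Fin m → ℕ

/-- The word that an `AddrWord` denotes on the tape `σ`. -/
def AddrWord.read {F : Type*} [Field F] {m N : ℕ} (a : AddrWord m N) (σ : List F) :
    FWord F m N :=
  fun i j => σ.getD (a i j) 0

/-- The tape positions of vectors `h₀` (`origin`) and `h₁, …, h_dim` (`dir`). -/
structure BasisOutput (m N : ℕ) where
  dim : ℕ
  origin : AddrWord m N
  dir : Fin dim → AddrWord m N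

/-- The affine subspace `{h₀ + ∑ i, c i • h i}`. -/
def affineSet {F : Type*} [Field F] {m N d : ℕ} (h₀ : FWord F m N) (h : Fin d → FWord F m N) :
    Set (FWord F m N) :=
  {w | ∃ c : Fin d → F, w = h₀ + ∑ i, c i • h i}

/-- The output `b`, read on the tape `σ`, is a basis of an affine subspace of dimension at most
`s - 1` that is contained in the code and contains the list of `g`. -/
def IsListBasis {F : Type*} [Field F] [DecidableEq F] {m N : ℕ} (k s : ℕ) (γ : F)
    (g : FWord F m N) (b : BasisOutput m N) (σ : List F) : Prop :=
  b.dim + 1 ≤ s ∧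
  LinearIndependent F (fun i => (b.dir i).read σ) ∧
  affineSet (b.origin.read σ) (fun i => (b.dir i).read σ) ⊆ frsCode m N k γ ∧
  frsList k γ g (frsRadius m N k s) ⊆ affineSet (b.origin.read σ) (fun i => (b.dir i).read σ)

/-- On every received word, every run of `A` outputs a basis as in `IsListBasis`, with at most `T`
field operations. -/
def ComputesListBasis {F : Type*} [Field F] [DecidableEq F] {m N : ℕ} (k s : ℕ) (γ : F)
    (A : CompTree (BasisOutput m N)) (T : ℕ) : Prop :=
  ∀ g : FWord F m N,
    A.worstOps (inputTape γ g) ≤ T ∧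
    ∀ o ∈ (A.run (inputTape γ g)).support, IsListBasis k s γ g o.1 o.2

/-- The set of words that an output denotes on the final tape. -/
def outputSet {F : Type*} [Field F] {m N : ℕ} (o : List (AddrWord m N) × List F) :
    Set (FWord F m N) :=
  {w | ∃ a ∈ o.1, AddrWord.read a o.2 = w}

/-!
The decoder runs `A` and then prunes the affine space it returns by pinning random blocks. One
round starts from the affine space, with direction space `V`. While `V` is not zero, it chooses a
block at random, keeps the words that agree with the received word on it, and replaces `V` by its
subspace that vanishes on the block. A codeword `w` of the list survives if it agrees with the
received word on all chosen blocks, and is then the only word left. At the end the candidate is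
compared with the received word, so nothing outside the list is ever output.

The choice is weighted. If `e` is the dimension of `V` and `e_i` that of its subspace vanishing on
block `i`, the block is chosen with probability proportional to `s * e_i + 1` if `e_i < e`, and
never if `e_i = e`. With these weights `w` is isolated with probability at least `1 / (s * e + 1)`,
by induction on `e` (`pow_le_card_isolatingSeeds`). The induction step needs that the `e_i` are
small on average: `(∑ e_i) * (m + 1 - e) ≤ e * k` (`sum_finrank_inf_ker_blockMap_le`). This is
proved with the determinant of `f_j (γ ^ l * X)`, for polynomials `f_j` that give a basis of `V`.
It is nonzero by a Vandermonde argument and has degree at most `e * k`, but it vanishes to order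
`e_i` at `m + 1 - e` points that belong to block `i`.

As `e ≤ s - 1`, a round isolates each list element with probability at least `1 / s ^ 2`. Different
list elements are isolated by disjoint sets of seeds, so there are at most `s ^ 2` of them, and
`O(s ^ 2 * log (s / β))` rounds find all of them with probability at least `1 - β`
(`exists_covering_finset`). In a round, each of at most `s` pinnings computes the numbers `e_i` by
Gaussian elimination on the single blocks and then eliminates one block in the full vectors, which
takes `O(s ^ 2 * m * N)` operations (`Prog.Spec.prune`). The total is
`O(m * s ^ 5 * log (s / β) * N)`.

All random choices after those of `A` are drawn at once, as a seed that is uniform on a product of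
copies of `Fin Q`, where `Q` is a multiple of every total weight that can occur. The rest of the
decoder is deterministic, and its correctness is a statement about each seed (`Prog.Spec`).
-/

/-! ### The determinant of dilated polynomials and the subspace design property -/

open Polynomial in
/-- The matrix with entries `f j (γ ^ l * X)`, in row `l` and column `j`. Its determinant plays
the part that the Wronskian plays for derivatives. -/
noncomputable def dilationMatrix {F : Type*} [Field F] {d : ℕ} (γ : F) (f : Fin d → F[X]) :
    Matrix (Fin d) (Fin d) F[X] :=
  Matrix.of fun l j => (f j).comp (C (γ ^ (l : ℕ)) * X)

section Design
open Polynomial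

variable {F : Type*} [Field F] {d : ℕ}

lemma dilationMatrix_linearCombination (γ : F) (f : Fin d → F[X]) (P : Matrix (Fin d) (Fin d) F) :
    dilationMatrix γ (fun j => ∑ l, P l j • f l) = dilationMatrix γ f * P.map C := by
  ext1 l j
  simp [dilationMatrix, Matrix.mul_apply, sum_comp, smul_eq_C_mul, mul_comm]

lemma coeff_prod_sum_of_natDegree_le {ι : Type*} (s : Finset ι) (f : ι → F[X]) (e : ι → ℕ)
    (h : ∀ i ∈ s, (f i).natDegree ≤ e i) :
    (∏ i ∈ s, f i).coeff (∑ i ∈ s, e i) = ∏ i ∈ s, (f i).coeff (e i) := by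
  classical
  induction s using Finset.induction_on with
  | empty => simp
  | insert a s ha ih =>
    rw [Finset.prod_insert ha, Finset.sum_insert ha, Finset.prod_insert ha,
      coeff_mul_add_eq_of_natDegree_le (h a (by simp)), ih fun i hi => h i (by simp [hi])]
    exact (natDegree_prod_le _ _).trans (Finset.sum_le_sum fun i hi => h i (by simp [hi]))

/-- The coefficient of the determinant at the sum of the degrees is a product of the leading
coefficients and a Vandermonde determinant in the distinct elements `γ ^ deg f j`. -/
lemma det_dilationMatrix_ne_zero_of_natDegree_injective {γ : F} {f : Fin d → F[X]}
    (hf : ∀ j, f j ≠ 0) (hdeg : ∀ j, (f j).natDegree < orderOf γ)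
    (hinj : Function.Injective fun j => (f j).natDegree) :
    (dilationMatrix γ f).det ≠ 0 := by
  set e : Fin d → ℕ := fun j => (f j).natDegree with he
  have key : (dilationMatrix γ f).det.coeff (∑ j, e j) =
      ((Matrix.vandermonde fun j => γ ^ e j).transpose *
        Matrix.diagonal fun j => (f j).coeff (e j)).det := by
    rw [Matrix.det_apply, Matrix.det_apply, finsetSum_coeff]
    refine Finset.sum_congr rfl fun σ _ => ?_
    rw [Units.smul_def, Units.smul_def, coeff_smul, coeff_prod_sum_of_natDegree_le]
    · congr 1
      refine Finset.prod_congr rfl fun j _ => ?_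
      rw [Matrix.mul_diagonal, dilationMatrix, Matrix.of_apply, comp_C_mul_X_coeff,
        Matrix.transpose_apply, Matrix.vandermonde_apply, ← pow_mul, ← pow_mul, mul_comm,
        mul_comm (e j)]
    · intro j _
      refine natDegree_comp_le.trans ?_
      calc _ ≤ e j * 1 := Nat.mul_le_mul_left _ ((natDegree_C_mul_le _ _).trans natDegree_X_le)
        _ = e j := mul_one _
  intro h0
  rw [h0, coeff_zero, Matrix.det_mul, Matrix.det_transpose, Matrix.det_diagonal] at key
  refine mul_ne_zero ?_ ?_ key.symm
  · rw [Matrix.det_vandermonde_ne_zero_iff]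
    intro i j hij
    exact hinj (pow_injOn_Iio_orderOf (hdeg i) (hdeg j) hij)
  · exact Finset.prod_ne_zero_iff.2 fun j _ => leadingCoeff_ne_zero.2 (hf j)

/-- A `d`-dimensional space of polynomials has nonzero elements of `d` different degrees: reading
off the coefficients at the degrees that occur is injective on the space. -/
lemma exists_natDegree_injective {f : Fin d → F[X]} (hf : LinearIndependent F f) :
    ∃ f' : Fin d → F[X], (∀ j, f' j ∈ Submodule.span F (Set.range f)) ∧ (∀ j, f' j ≠ 0) ∧
      Function.Injective fun j => (f' j).natDegree := by
  classical
  set U := Submodule.span F (Set.range f)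
  have hU : Module.finrank F U = d := by simpa using finrank_span_eq_card hf
  have : FiniteDimensional F U := FiniteDimensional.span_of_finite F (Set.finite_range f)
  let E : Set ℕ := {e | ∃ u ∈ U, u ≠ 0 ∧ u.natDegree = e}
  have hE : ∃ D : Fin d → ℕ, Function.Injective D ∧ ∀ j, D j ∈ E := by
    by_cases hfin : E.Finite
    · have := hfin.fintype
      let φ : U →ₗ[F] (E → F) := LinearMap.pi fun e => (lcoeff F e.1).comp U.subtype
      have hφ : Function.Injective φ := by
        rw [injective_iff_map_eq_zero]
        intro u hu
        by_contra hne
        have hne' : (u : F[X]) ≠ 0 := by simpa using hne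
        have := congrFun hu ⟨(u : F[X]).natDegree, u, u.2, hne', rfl⟩
        exact hne' (leadingCoeff_eq_zero.1 this)
      have hle := LinearMap.finrank_le_finrank_of_injective hφ
      rw [hU, Module.finrank_pi] at hle
      obtain ⟨g⟩ := Function.Embedding.nonempty_of_card_le
        (α := Fin d) (β := E) (by simpa using hle)
      exact ⟨fun j => g j, Subtype.val_injective.comp g.injective, fun j => (g j).2⟩
    · have hinf : E.Infinite := hfin
      let g := hinf.natEmbedding
      exact ⟨fun j => g j, fun i j h => Fin.ext (g.injective (Subtype.ext h)), fun j => (g j).2⟩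
  obtain ⟨D, hD, hDE⟩ := hE
  choose u hu hne hdeg using hDE
  refine ⟨u, hu, hne, fun i j hij => hD ?_⟩
  simpa [hdeg] using hij

lemma det_dilationMatrix_ne_zero {γ : F} {k : ℕ} (hk : k ≤ orderOf γ) {f : Fin d → F[X]}
    (hf : LinearIndependent F f) (hdeg : ∀ j, (f j).degree < k) :
    (dilationMatrix γ f).det ≠ 0 := by
  obtain ⟨f', hmem, hne, hinj⟩ := exists_natDegree_injective hf
  have hcomb : ∀ j, ∃ c : Fin d → F, ∑ l, c l • f l = f' j := fun j =>
    (Submodule.mem_span_range_iff_exists_fun F).1 (hmem j)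
  choose c hc using hcomb
  have hsub : Submodule.span F (Set.range f) ≤ degreeLT F k := by
    rw [Submodule.span_le]
    rintro _ ⟨j, rfl⟩
    exact mem_degreeLT.2 (hdeg j)
  have h1 := det_dilationMatrix_ne_zero_of_natDegree_injective hne (γ := γ) (fun j =>
    ((natDegree_lt_iff_degree_lt (hne j)).2 (mem_degreeLT.1 (hsub (hmem j)))).trans_le hk) hinj
  have h2 : f' = fun j => ∑ l, (Matrix.of fun l j => c j l) l j • f l := by
    funext j; simp [hc]
  rw [h2, dilationMatrix_linearCombination, Matrix.det_mul] at h1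
  exact left_ne_zero_of_mul h1

lemma natDegree_det_dilationMatrix_le {γ : F} {k : ℕ} {f : Fin d → F[X]}
    (hdeg : ∀ j, (f j).degree < k) : (dilationMatrix γ f).det.natDegree ≤ d * k := by
  rw [Matrix.det_apply]
  refine natDegree_sum_le_of_forall_le _ _ fun σ _ => ?_
  rw [Units.smul_def]
  refine (natDegree_smul_le _ _).trans ((natDegree_prod_le _ _).trans ?_)
  calc _ ≤ ∑ _j : Fin d, k := Finset.sum_le_sum fun j _ => by
        refine natDegree_comp_le.trans ?_
        calc _ ≤ k * 1 := Nat.mul_le_mul (natDegree_le_of_degree_le (hdeg j).le)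
              ((natDegree_C_mul_le _ _).trans natDegree_X_le)
          _ = k := mul_one _
    _ = d * k := by simp

lemma pow_X_sub_C_dvd_det {M : Matrix (Fin d) (Fin d) F[X]} {a : F} (S : Finset (Fin d))
    (h : ∀ l, ∀ j ∈ S, (M l j).eval a = 0) : (X - C a) ^ S.card ∣ M.det := by
  rw [Matrix.det_apply]
  refine Finset.dvd_sum fun σ _ => ?_
  rw [Units.smul_def, zsmul_eq_mul]
  refine Dvd.dvd.mul_left ?_ _
  rw [← Finset.prod_const]
  refine (Finset.prod_dvd_prod_of_dvd _ _ fun j hj => dvd_iff_isRoot.2 (h (σ j) j hj)).trans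
    (Finset.prod_dvd_prod_of_subset _ _ _ (Finset.subset_univ _))

/-- A basis of `V`, indexed by `Fin d`, of which a part of the right size lies in `U`. -/
lemma exists_basis_adapted {V : Type*} [AddCommGroup V] [Module F V] [FiniteDimensional F V]
    (hd : Module.finrank F V = d) (U : Submodule F V) :
    ∃ (b : Module.Basis (Fin d) F V) (S : Finset (Fin d)), S.card = Module.finrank F U ∧
      ∀ j ∈ S, b j ∈ U := by
  classical
  obtain ⟨U', hU'⟩ := Submodule.exists_isCompl U
  let b₀ := ((Module.finBasis F U).prod (Module.finBasis F U')).map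
    (Submodule.prodEquivOfIsCompl U U' hU')
  have hcard : Fintype.card (Fin (Module.finrank F U) ⊕ Fin (Module.finrank F U')) = d := by
    rw [← Module.finrank_eq_card_basis b₀, hd]
  let e := Fintype.equivFinOfCardEq hcard
  refine ⟨b₀.reindex e, Finset.univ.map (Function.Embedding.inl.trans e.toEmbedding), by simp, ?_⟩
  intro j hj
  obtain ⟨i, -, rfl⟩ := Finset.mem_map.1 hj
  simp [b₀]

/-- The `i`-th symbol of an uncurried word, as a linear map. -/
def blockMap (F : Type*) [Field F] {N m : ℕ} (i : Fin N) :
    (Fin N × Fin m → F) →ₗ[F] (Fin m → F) :=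
  LinearMap.funLeft F F fun j => (i, j)

@[simp] lemma blockMap_apply {N m : ℕ} (i : Fin N) (v : Fin N × Fin m → F) (j : Fin m) :
    blockMap F i v j = v (i, j) := rfl

/-- The subspace design property of folded Reed–Solomon codes: a subspace `V` of the code cannot
lose little dimension on many blocks. The determinant of the dilated polynomials of a basis of `V`
has degree at most `finrank V * k`, and in each block `i` it vanishes at `m + 1 - finrank V`
points, to order at least the dimension of the subspace of `V` that vanishes on the block. -/
theorem sum_finrank_inf_ker_blockMap_le {N m k : ℕ} {γ : F} (hk : k ≤ m * N)
    (hγ : m * N ≤ orderOf γ) (V : Submodule F (Fin N × Fin m → F))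
    (hV : ∀ v ∈ V, ∃ f : F[X], f.degree < k ∧
      ∀ i j, v (i, j) = f.eval (γ ^ (m * (i : ℕ) + (j : ℕ))))
    (hd : Module.finrank F V ≤ m) :
    (∑ i, Module.finrank F (V ⊓ LinearMap.ker (blockMap F i) : Submodule F _)) *
      (m + 1 - Module.finrank F V) ≤ Module.finrank F V * k := by
  classical
  obtain ⟨d, hd'⟩ : ∃ d, Module.finrank F V = d := ⟨_, rfl⟩
  rw [hd'] at hd ⊢
  let b : Module.Basis (Fin d) F V := Module.finBasisOfFinrankEq F V hd'
  choose f hfdeg hfeval using fun j => hV (b j) (b j).2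
  have hflin : LinearIndependent F f := by
    rw [Fintype.linearIndependent_iff]
    intro c hc
    refine Fintype.linearIndependent_iff.1 b.linearIndependent c ?_
    apply Subtype.ext
    funext ⟨i, j⟩
    have := congrArg (eval (γ ^ (m * (i : ℕ) + (j : ℕ)))) hc
    simpa [eval_finsetSum, ← hfeval] using this
  have hD := det_dilationMatrix_ne_zero (hk.trans hγ) hflin hfdeg
  set D := (dilationMatrix γ f).det
  set r : Fin N → ℕ := fun i => Module.finrank F (V ⊓ LinearMap.ker (blockMap F i) : Submodule F _)
  have hlt : ∀ (i : Fin N) (j : ℕ), j < m → m * (i : ℕ) + j < m * N := fun i j hj =>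
    calc m * (i : ℕ) + j < m * (i : ℕ) + m := by omega
      _ = m * (i + 1) := by ring
      _ ≤ m * N := Nat.mul_le_mul_left _ i.2
  -- Passing to a basis adapted to block `i` changes the determinant by a unit only.
  have hdvd : ∀ (i : Fin N) (j : Fin (m + 1 - d)),
      (X - C (γ ^ (m * (i : ℕ) + (j : ℕ)))) ^ r i ∣ D := by
    intro i j
    obtain ⟨b', S, hS, hmem⟩ := exists_basis_adapted hd'
      ((LinearMap.ker (blockMap F i)).comap V.subtype)
    have hSr : S.card = r i := by
      rw [hS]
      have := (LinearEquiv.finrank_eq (Submodule.equivMapOfInjective V.subtype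
        V.injective_subtype ((LinearMap.ker (blockMap F i)).comap V.subtype)))
      rw [this, Submodule.map_comap_subtype]
    set P := b.toMatrix b'
    have hP : IsUnit P.det := by
      let _ := b.invertibleToMatrix b'
      exact (Matrix.isUnit_iff_isUnit_det _).1 (isUnit_of_invertible _)
    have hcol : ∀ j', (b' j' : Fin N × Fin m → F) = ∑ l, P l j' • (b l : Fin N × Fin m → F) := by
      intro j'
      have := congrArg V.subtype (b.sum_toMatrix_smul_self b' j')
      simpa [-Module.Basis.sum_toMatrix_smul_self] using this.symm
    have h1 : (X - C (γ ^ (m * (i : ℕ) + (j : ℕ)))) ^ S.card ∣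
        (dilationMatrix γ fun j' => ∑ l, P l j' • f l).det := by
      refine pow_X_sub_C_dvd_det S fun l j' hj' => ?_
      have hlm : (j : ℕ) + l < m := by omega
      have h0 := congrFun (LinearMap.mem_ker.1 (Submodule.mem_comap.1 (hmem j' hj')))
        ⟨(j : ℕ) + l, hlm⟩
      rw [blockMap_apply, Submodule.subtype_apply, hcol] at h0
      simp only [Finset.sum_apply, Pi.smul_apply, hfeval] at h0
      rw [dilationMatrix, Matrix.of_apply, eval_comp, eval_finsetSum]
      have hexp : (l : ℕ) + (m * (i : ℕ) + j) = m * i + (j + l) := by ring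
      simp only [eval_smul, eval_mul, eval_C, eval_X, ← pow_add, hexp]
      exact h0
    rw [dilationMatrix_linearCombination, Matrix.det_mul, hSr] at h1
    have h2 : IsUnit (P.map C).det := by
      have := hP.map (C : F →+* F[X])
      rwa [RingHom.map_det] at this
    exact h2.dvd_mul_right.1 h1
  have hprod : ∏ p : Fin N × Fin (m + 1 - d),
      (X - C (γ ^ (m * (p.1 : ℕ) + (p.2 : ℕ)))) ^ r p.1 ∣ D := by
    -- For `d = 0` the points would run beyond the block, but all exponents are zero.
    by_cases hd0 : d = 0
    · subst hd0
      have hr : ∀ i, r i = 0 := fun i => Nat.le_zero.1 (hd' ▸ Submodule.finrank_mono inf_le_left)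
      simp [hr]
    · refine Finset.prod_dvd_of_coprime (fun p _ q _ hpq => ?_) fun p _ => hdvd p.1 p.2
      refine IsCoprime.pow (isCoprime_X_sub_C_of_isUnit_sub ?_)
      rw [isUnit_iff_ne_zero, sub_ne_zero]
      intro h
      have hp := hlt p.1 p.2 (by omega)
      have hq := hlt q.1 q.2 (by omega)
      have := pow_injOn_Iio_orderOf (hp.trans_le hγ) (hq.trans_le hγ) h
      apply hpq
      have hm : 0 < m := by omega
      have e1 : (p.1 : ℕ) = q.1 := by
        have := congrArg (· / m) this
        simpa [Nat.mul_add_div hm, Nat.div_eq_of_lt (show (p.2 : ℕ) < m by omega),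
          Nat.div_eq_of_lt (show (q.2 : ℕ) < m by omega)] using this
      rw [e1] at this
      exact Prod.ext (Fin.ext e1) (Fin.ext (by omega))
  have := (natDegree_le_of_dvd hprod hD).trans (natDegree_det_dilationMatrix_le hfdeg)
  rw [natDegree_prod_of_monic _ _ fun p _ => (monic_X_sub_C _).pow _] at this
  simp only [natDegree_pow, natDegree_X_sub_C] at this
  simpa [Fintype.sum_prod_type, Finset.mul_sum, mul_comm] using this

end Design

/-! ### Sequencing computation trees, and programs with cost and output specifications -/

namespace CompTree

variable {α β : Type} {F : Type*} [Field F] [DecidableEq F]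

/-- `p.bind f n` continues every leaf of `p` with the tree that `f` assigns to its output. The
continuation also receives the length of the tape at that leaf, where `n` is the length of the
tape at the root: the length grows by one at each arithmetic node and so is known to the tree. -/
def bind : CompTree α → (α → ℕ → CompTree β) → ℕ → CompTree β
  | halt a, f, n => f a n
  | op o a b next, f, n => op o a b (next.bind f (n + 1))
  | ifEq a b yes no, f, n => ifEq a b (yes.bind f n) (no.bind f n)
  | rand k branch, f, n => rand k fun i => (branch i).bind f n

lemma isPrefix_of_mem_support_run (p : CompTree α) (σ : List F) :
    ∀ o ∈ (p.run σ).support, σ <+: o.2 := by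
  induction p generalizing σ with
  | halt a => simp [run]
  | op o a b next ih =>
    intro x hx
    exact (List.prefix_append _ _).trans (ih _ x hx)
  | ifEq a b yes no ihy ihn =>
    intro x hx
    simp only [run] at hx
    split_ifs at hx
    · exact ihy _ x hx
    · exact ihn _ x hx
  | rand k branch ih =>
    intro x hx
    simp only [run, PMF.mem_support_bind_iff] at hx
    obtain ⟨i, -, hi⟩ := hx
    exact ih i _ x hi

lemma run_bind (p : CompTree α) (f : α → ℕ → CompTree β) (σ : List F) :
    (p.bind f σ.length).run σ = (p.run σ).bind fun o => (f o.1 o.2.length).run o.2 := by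
  induction p generalizing σ with
  | halt a => simp [run, bind]
  | op o a b next ih =>
    simp only [run, bind]
    rw [← ih]
    simp
  | ifEq a b yes no ihy ihn =>
    simp only [run, bind]
    split_ifs
    · exact ihy σ
    · exact ihn σ
  | rand k branch ih =>
    simp only [run, bind, PMF.bind_bind, ih]

lemma worstOps_bind_le (p : CompTree α) (f : α → ℕ → CompTree β) (σ : List F) {c₁ c₂ : ℕ}
    (h₁ : p.worstOps σ ≤ c₁)
    (h₂ : ∀ o ∈ (p.run σ).support, (f o.1 o.2.length).worstOps o.2 ≤ c₂) :
    (p.bind f σ.length).worstOps σ ≤ c₁ + c₂ := by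
  suffices h : (p.bind f σ.length).worstOps σ ≤ p.worstOps σ + c₂ from h.trans (by omega)
  clear h₁
  induction p generalizing σ with
  | halt a => simpa [run, bind, worstOps] using h₂
  | op o a b next ih =>
    have := ih (σ ++ [o.eval (σ.getD a 0) (σ.getD b 0)]) h₂
    simp only [bind, worstOps]
    simp only [List.length_append, List.length_singleton] at this
    omega
  | ifEq a b yes no ihy ihn =>
    simp only [run] at h₂
    simp only [bind, worstOps]
    split_ifs at h₂ ⊢ with h
    · have := ihy σ h₂; omega
    · have := ihn σ h₂; omega
  | rand k branch ih =>
    simp only [bind, worstOps]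
    refine Finset.sup_le fun i _ => (ih i σ fun o ho => h₂ o ?_).trans ?_
    · simp only [run, PMF.mem_support_bind_iff]
      exact ⟨i, by simp, ho⟩
    · exact Nat.add_le_add_right
        (Finset.le_sup (f := fun i => worstOps (branch i) σ) (Finset.mem_univ i)) _

end CompTree

/-- A computation tree that may depend on the length of the tape on which it starts. -/
abbrev Prog (α : Type) : Type := ℕ → CompTree α

namespace Prog

variable {α β : Type} {F : Type*} [Field F] [DecidableEq F]

/-- The program that stops with output `a`. -/
def ret (a : α) : Prog α := fun _ => .halt a

/-- Sequential composition of programs. -/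
def andThen (p : Prog α) (f : α → Prog β) : Prog β := fun n => (p n).bind f n

/-- One arithmetic operation, which outputs the position of its result. -/
def arith (o : ArithOp) (a b : ℕ) : Prog ℕ := fun n => .op o a b (.halt n)

/-- One equality test. -/
def testEq (a b : ℕ) : Prog Bool := fun _ => .ifEq a b (.halt true) (.halt false)

/-- Started on the tape `σ`, every run of `p` takes at most `c` field operations and ends with an
output and a tape that satisfy `Q`. -/
def Spec (p : Prog α) (σ : List F) (c : ℕ) (Q : α → List F → Prop) : Prop :=
  (p σ.length).worstOps σ ≤ c ∧ ∀ o ∈ ((p σ.length).run σ).support, Q o.1 o.2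

lemma Spec.mono {p : Prog α} {σ : List F} {c c' : ℕ} {Q Q' : α → List F → Prop}
    (h : p.Spec σ c Q) (hc : c ≤ c') (hQ : ∀ a σ', σ <+: σ' → Q a σ' → Q' a σ') :
    p.Spec σ c' Q' :=
  ⟨h.1.trans hc, fun o ho => hQ _ _ (CompTree.isPrefix_of_mem_support_run _ _ o ho) (h.2 o ho)⟩

lemma Spec.ret {a : α} {σ : List F} {Q : α → List F → Prop} (h : Q a σ) :
    (Prog.ret a).Spec σ 0 Q := by
  simp [Spec, Prog.ret, CompTree.worstOps, CompTree.run, h]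

lemma Spec.andThen {p : Prog α} {f : α → Prog β} {σ : List F} {c₁ c₂ : ℕ}
    {Q : α → List F → Prop} {R : β → List F → Prop} (hp : p.Spec σ c₁ Q)
    (hf : ∀ a σ', σ <+: σ' → Q a σ' → (f a).Spec σ' c₂ R) :
    (p.andThen f).Spec σ (c₁ + c₂) R := by
  have hf' : ∀ o ∈ ((p σ.length).run σ).support, (f o.1).Spec o.2 c₂ R := fun o ho =>
    hf _ _ (CompTree.isPrefix_of_mem_support_run _ _ o ho) (hp.2 o ho)
  refine ⟨CompTree.worstOps_bind_le _ _ _ hp.1 fun o ho => (hf' o ho).1, fun o ho => ?_⟩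
  rw [Prog.andThen, CompTree.run_bind, PMF.mem_support_bind_iff] at ho
  obtain ⟨o', ho', h⟩ := ho
  exact (hf' o' ho').2 o h

lemma Spec.arith {o : ArithOp} {a b : ℕ} {σ : List F} {x y : F}
    (ha : σ[a]? = some x) (hb : σ[b]? = some y) :
    (Prog.arith o a b).Spec σ 1 fun r σ' => σ'[r]? = some (o.eval x y) := by
  simp [Spec, Prog.arith, CompTree.worstOps, CompTree.run, List.getD_eq_getElem?_getD, ha, hb]

lemma Spec.testEq {a b : ℕ} {σ : List F} {x y : F}
    (ha : σ[a]? = some x) (hb : σ[b]? = some y) :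
    (Prog.testEq a b).Spec σ 1 fun r _ => (r = true ↔ x = y) := by
  by_cases h : x = y <;>
  simp [Spec, Prog.testEq, CompTree.worstOps, CompTree.run, List.getD_eq_getElem?_getD, ha, hb, h]

/-- Run the programs `f 0, f 1, …` in turn and collect their outputs. -/
def tabulateFin : {M : ℕ} → (Fin M → Prog α) → Prog (Fin M → α)
  | 0, _ => ret Fin.elim0
  | _ + 1, f => (f 0).andThen fun a => (tabulateFin fun j => f j.succ).andThen fun b =>
      ret (Fin.cons a b : Fin _ → α)

lemma Spec.tabulateFin {M : ℕ} {f : Fin M → Prog α} {σ : List F} {c : ℕ}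
    {Q : Fin M → α → List F → Prop}
    (hQ : ∀ j a σ₁ σ₂, σ₁ <+: σ₂ → Q j a σ₁ → Q j a σ₂)
    (hf : ∀ j σ', σ <+: σ' → (f j).Spec σ' c (Q j)) :
    (Prog.tabulateFin f).Spec σ (M * c) fun a σ' => ∀ j, Q j (a j) σ' := by
  induction M generalizing σ with
  | zero => exact (Spec.ret (fun j => j.elim0)).mono (by simp) fun _ _ _ h => h
  | succ M ih =>
    refine ((hf 0 σ List.prefix_rfl).andThen fun a σ₁ h₁ ha =>
      (ih (fun j => hQ j.succ) fun j σ' h => hf j.succ σ' (h₁.trans h)).andThen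
        fun b σ₂ h₂ hb => Spec.ret
          (Q := fun (a : Fin (M + 1) → α) σ' => ∀ j, Q j (a j) σ') ?_).mono
      (c' := (M + 1) * c) (by ring_nf; omega) fun _ _ _ h => h
    intro j
    refine Fin.cases ?_ (fun j => ?_) j
    · exact hQ _ _ _ _ h₂ ha
    · exact hb j

/-- `tabulateFin` for an arbitrary finite index type, in the order of an arbitrary enumeration. -/
noncomputable def tabulate {ι : Type} [Fintype ι] (f : ι → Prog α) : Prog (ι → α) :=
  (tabulateFin fun j => f ((Fintype.equivFin ι).symm j)).andThen fun a =>
    ret fun i => a (Fintype.equivFin ι i)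

lemma Spec.tabulate {ι : Type} [Fintype ι] {f : ι → Prog α} {σ : List F} {c : ℕ}
    {Q : ι → α → List F → Prop}
    (hQ : ∀ j a σ₁ σ₂, σ₁ <+: σ₂ → Q j a σ₁ → Q j a σ₂)
    (hf : ∀ j σ', σ <+: σ' → (f j).Spec σ' c (Q j)) :
    (Prog.tabulate f).Spec σ (Fintype.card ι * c) fun a σ' => ∀ j, Q j (a j) σ' := by
  refine (Spec.tabulateFin (Q := fun j => Q ((Fintype.equivFin ι).symm j)) (fun j => hQ _)
    fun j σ' h => hf _ σ' h).andThen (c₂ := 0) fun a σ' h ha => Spec.ret fun j => ?_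
  have := ha (Fintype.equivFin ι j)
  rwa [Equiv.symm_apply_apply] at this

/-- Search a list of coordinates for one at which the vector stored at `v` is nonzero. The position
`z` has to hold zero. -/
def findNonzero {κ : Type} (z : ℕ) (v : κ → ℕ) : List κ → Prog (Option κ)
  | [] => ret none
  | p :: l => (testEq (v p) z).andThen fun r => if r then findNonzero z v l else ret (some p)

end Prog

/-- The tape `σ` holds the vector `x` at the positions `v`, all of which lie within the tape, so
that this persists when the tape is extended. -/
def RepVec {F : Type*} {ι : Type} (σ : List F) (v : ι → ℕ) (x : ι → F) : Prop :=
  ∀ j, σ[v j]? = some (x j)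

lemma List.IsPrefix.getElem?_eq_some {F : Type*} {σ σ' : List F} (h : σ <+: σ') {a : ℕ} {x : F}
    (ha : σ[a]? = some x) : σ'[a]? = some x := by
  obtain ⟨τ, rfl⟩ := h
  obtain ⟨hlt, -⟩ := List.getElem?_eq_some_iff.1 ha
  rw [List.getElem?_append_left hlt, ha]

lemma RepVec.mono {F : Type*} {ι : Type} {σ σ' : List F} {v : ι → ℕ} {x : ι → F}
    (hv : RepVec σ v x) (h : σ <+: σ') : RepVec σ' v x :=
  fun j => h.getElem?_eq_some (hv j)

namespace Prog

variable {α β : Type} {F : Type*} [Field F] [DecidableEq F]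

lemma Spec.findNonzero {κ : Type} {z : ℕ} {v : κ → ℕ} {σ : List F} {x : κ → F}
    (hz : σ[z]? = some 0) (hv : RepVec σ v x) (l : List κ) :
    (Prog.findNonzero z v l).Spec σ l.length fun r _ =>
      (r = none → ∀ p ∈ l, x p = 0) ∧ ∀ p, r = some p → x p ≠ 0 := by
  induction l generalizing σ with
  | nil => exact Spec.ret (by simp)
  | cons p l ih =>
    refine ((Spec.testEq (hv p) hz).andThen fun r σ₁ h₁ hr => ?_).mono (c := 1 + l.length)
      (by simp; omega) fun _ _ _ h => h
    cases r with
    | true =>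
      refine (ih (h₁.getElem?_eq_some hz) (hv.mono h₁)).mono le_rfl fun a σ' _ h => ⟨?_, h.2⟩
      simp only [List.mem_cons, forall_eq_or_imp]
      exact fun ha => ⟨hr.1 rfl, h.1 ha⟩
    | false =>
      refine (Spec.ret ⟨by simp, ?_⟩).mono (Nat.zero_le _) fun _ _ _ h => h
      intro q hq
      cases hq
      exact fun h => Bool.false_ne_true (hr.2 h)

/-- Run `f` on the entries of a list in turn. -/
def mapList (f : α → Prog β) : List α → Prog (List β)
  | [] => ret []
  | a :: l => (f a).andThen fun b => (mapList f l).andThen fun bs => ret (b :: bs)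

lemma Spec.mapList {ι : Type} {f : (ι → ℕ) → Prog (ι → ℕ)} {φ : (ι → F) → (ι → F)} {c : ℕ}
    {σ : List F} {l : List (ι → ℕ)} {xs : List (ι → F)} (hl : List.Forall₂ (RepVec σ) l xs)
    (hf : ∀ v x σ', σ <+: σ' → RepVec σ' v x → (f v).Spec σ' c fun a σ'' => RepVec σ'' a (φ x)) :
    (Prog.mapList f l).Spec σ (l.length * c) fun a σ' =>
      List.Forall₂ (RepVec σ') a (xs.map φ) := by
  induction l generalizing σ xs with
  | nil =>
    cases hl
    exact (Spec.ret .nil).mono (by simp) fun _ _ _ h => h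
  | cons v l ih =>
    cases hl with
    | cons hv hl =>
    refine ((hf _ _ σ List.prefix_rfl hv).andThen fun a σ₁ h₁ ha =>
      (ih (hl.imp fun _ _ h => h.mono h₁) fun v x σ' h => hf v x σ' (h₁.trans h)).andThen
        fun b σ₂ h₂ hb => Spec.ret (.cons (ha.mono h₂) hb)).mono
      (by simp; ring_nf; omega) fun _ _ _ h => h

end Prog

/-! ### Counted Gaussian elimination on a set of coordinates -/

section LinearAlgebra

variable {F : Type*} [Field F] {ι κ : Type}

/-- The span of the vectors in a list. -/
abbrev listSpan (xs : List (ι → F)) : Submodule F (ι → F) := Submodule.span F {x | x ∈ xs}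

lemma listSpan_cons (x : ι → F) (xs : List (ι → F)) :
    listSpan (x :: xs) = Submodule.span F {x} ⊔ listSpan xs := by
  rw [listSpan, listSpan, ← Submodule.span_union]
  congr 1
  ext y
  simp

lemma listSpan_nil : listSpan ([] : List (ι → F)) = ⊥ := by simp [listSpan]

lemma listSpan_map {ι' : Type} (f : (ι → F) →ₗ[F] (ι' → F)) (xs : List (ι → F)) :
    listSpan (xs.map f) = (listSpan xs).map f := by
  rw [listSpan, Submodule.map_span]
  congr 1
  ext y
  simp

/-- The map `y ↦ y - (y p / x p) • x`, which clears the coordinate `p` by means of `x`. It is a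
projection along `x` onto the vectors that vanish at `p` when `x p ≠ 0`, and the identity when
`x p = 0`. -/
def clearCoord (x : ι → F) (p : ι) : (ι → F) →ₗ[F] (ι → F) :=
  LinearMap.id - ((x p)⁻¹ • LinearMap.proj p).smulRight x

lemma clearCoord_apply (x : ι → F) (p : ι) (y : ι → F) :
    clearCoord x p y = y - (y p / x p) • x := by
  simp [clearCoord, div_eq_inv_mul]

/-- `(xs', δ')` results from `(xs, δ)` by eliminating the coordinates that `ρ` reads: `xs'` spans
the part of the span of `xs` on which `ρ` vanishes, one vector is dropped for each dimension of the
image under `ρ`, and `δ' + span xs'` contains all vectors of `δ + span xs` on which `ρ` vanishes. -/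
structure Eliminated (ρ : (ι → F) →ₗ[F] (κ → F)) (xs : List (ι → F)) (δ : ι → F)
    (xs' : List (ι → F)) (δ' : ι → F) : Prop where
  span_eq : listSpan xs' = listSpan xs ⊓ LinearMap.ker ρ
  length_add : xs'.length + Module.finrank F ((listSpan xs).map ρ) = xs.length
  sub_mem : δ' - δ ∈ listSpan xs
  sub_mem_of_map_eq_zero : ∀ ε, ε - δ ∈ listSpan xs → ρ ε = 0 → ε - δ' ∈ listSpan xs'

lemma Eliminated.nil (ρ : (ι → F) →ₗ[F] (κ → F)) (δ : ι → F) : Eliminated ρ [] δ [] δ where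
  span_eq := by simp [listSpan_nil]
  length_add := by rw [listSpan_nil, Submodule.map_bot, finrank_bot]; rfl
  sub_mem := by simp
  sub_mem_of_map_eq_zero := fun ε h _ => h

/-- A first vector on which `ρ` already vanishes is kept. -/
lemma Eliminated.keep {ρ : (ι → F) →ₗ[F] (κ → F)} {xs : List (ι → F)} {δ : ι → F}
    {xs' : List (ι → F)} {δ' : ι → F} (h : Eliminated ρ xs δ xs' δ') {x : ι → F} (hx : ρ x = 0) :
    Eliminated ρ (x :: xs) δ (x :: xs') δ' where
  span_eq := by
    rw [listSpan_cons, listSpan_cons, h.span_eq, sup_inf_assoc_of_le]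
    simpa [Submodule.span_singleton_le_iff_mem] using hx
  length_add := by
    rw [listSpan_cons, Submodule.map_sup, Submodule.map_span, Set.image_singleton, hx,
      Submodule.span_zero_singleton, bot_sup_eq, List.length_cons, List.length_cons,
      ← h.length_add]
    omega
  sub_mem := by
    rw [listSpan_cons]
    exact Submodule.mem_sup_right h.sub_mem
  sub_mem_of_map_eq_zero := fun ε hε h0 => by
    rw [listSpan_cons, Submodule.mem_sup] at hε
    obtain ⟨y, hy, w, hw, hyw⟩ := hε
    obtain ⟨c, rfl⟩ := Submodule.mem_span_singleton.1 hy
    have h1 := h.sub_mem_of_map_eq_zero (ε - c • x) (by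
      rwa [show ε - c • x - δ = w by rw [sub_right_comm, ← hyw]; simp]) (by simp [hx, h0])
    rw [listSpan_cons]
    rw [show ε - δ' = c • x + (ε - c • x - δ') by abel]
    exact Submodule.add_mem_sup hy h1

/-- A first vector that is nonzero at some coordinate is used to clear that coordinate in all other
vectors, and then dropped. -/
lemma Eliminated.pivot [Finite κ] {pos : κ → ι} {xs : List (ι → F)} {δ : ι → F} {x : ι → F}
    {p : κ} (hp : x (pos p) ≠ 0) {xs' : List (ι → F)} {δ' : ι → F}
    (h : Eliminated (LinearMap.funLeft F F pos) (xs.map (clearCoord x (pos p)))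
      (clearCoord x (pos p) δ) xs' δ') :
    Eliminated (LinearMap.funLeft F F pos) (x :: xs) δ xs' δ' := by
  set R := clearCoord x (pos p) with hR
  set ρ := LinearMap.funLeft F F pos
  have hRx : R x = 0 := by rw [hR, clearCoord_apply, div_self hp, one_smul, sub_self]
  have hRp : ∀ y, R y (pos p) = 0 := fun y => by
    rw [hR, clearCoord_apply]
    simp [div_mul_cancel₀ _ hp]
  have hRfix : ∀ y, y (pos p) = 0 → R y = y := fun y hy => by
    rw [hR, clearCoord_apply, hy]; simp
  have hxmem : ∀ c : F, c • x ∈ listSpan (x :: xs) := fun c =>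
    Submodule.smul_mem _ _ (Submodule.subset_span (by simp))
  have hmap : (listSpan (x :: xs)).map R = listSpan (xs.map R) := by
    rw [listSpan_cons, Submodule.map_sup, Submodule.map_span, Set.image_singleton, hRx,
      Submodule.span_zero_singleton, bot_sup_eq, listSpan_map]
  have hle : listSpan (xs.map R) ≤ listSpan (x :: xs) := by
    rw [← hmap]
    rintro _ ⟨y, hy, rfl⟩
    rw [hR, clearCoord_apply]
    exact Submodule.sub_mem _ hy (hxmem _)
  have hvan : ∀ y ∈ listSpan (xs.map R), y (pos p) = 0 := by
    rw [← hmap]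
    rintro _ ⟨y, -, rfl⟩
    exact hRp y
  have hρp : ∀ y, ρ y = 0 → y (pos p) = 0 := fun y hy => congrFun hy p
  have hδ : R δ - δ ∈ listSpan (x :: xs) := by
    rw [hR, clearCoord_apply, sub_sub_cancel_left, ← neg_smul]
    exact hxmem _
  refine ⟨?_, ?_, ?_, ?_⟩
  · rw [h.span_eq]
    refine le_antisymm (inf_le_inf_right _ hle) fun y hy => ⟨?_, hy.2⟩
    rw [← hmap, ← hRfix y (hρp y hy.2)]
    exact Submodule.mem_map_of_mem hy.1
  · have hsup : (listSpan (x :: xs)).map ρ =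
        Submodule.span F {ρ x} ⊔ (listSpan (xs.map R)).map ρ := by
      refine le_antisymm ?_ (sup_le ?_ (Submodule.map_mono hle))
      · rintro _ ⟨y, hy, rfl⟩
        rw [show y = (y (pos p) / x (pos p)) • x + R y by
          rw [hR, clearCoord_apply]; abel, map_add, map_smul]
        refine Submodule.add_mem_sup (Submodule.smul_mem _ _ (Submodule.mem_span_singleton_self _)) ?_
        exact Submodule.mem_map_of_mem (hmap ▸ Submodule.mem_map_of_mem hy)
      · rw [Submodule.span_singleton_le_iff_mem]
        exact Submodule.mem_map_of_mem (by simpa using hxmem 1)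
    have hinf : Submodule.span F {ρ x} ⊓ (listSpan (xs.map R)).map ρ = ⊥ := by
      rw [eq_bot_iff]
      rintro _ ⟨hy, w, hw, rfl⟩
      obtain ⟨c, hc⟩ := Submodule.mem_span_singleton.1 hy
      have h0 : c * x (pos p) = 0 := by
        have := congrFun hc p
        simpa [ρ, LinearMap.funLeft_apply, hvan w hw] using this
      rw [(mul_eq_zero.1 h0).resolve_right hp, zero_smul] at hc
      exact hc.symm
    have hne : ρ x ≠ 0 := fun h0 => hp (hρp x h0)
    have := Submodule.finrank_sup_add_finrank_inf_eq (Submodule.span F {ρ x})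
      ((listSpan (xs.map R)).map ρ)
    rw [hinf, finrank_bot, finrank_span_singleton hne, ← hsup] at this
    have hlen := h.length_add
    rw [List.length_map] at hlen
    rw [List.length_cons]
    omega
  · rw [show δ' - δ = (δ' - R δ) + (R δ - δ) by abel]
    exact Submodule.add_mem _ (hle h.sub_mem) hδ
  · intro ε hε h0
    refine h.sub_mem_of_map_eq_zero ε ?_ h0
    rw [← hRfix ε (hρp ε h0), ← map_sub, ← hmap]
    exact Submodule.mem_map_of_mem hε

lemma finrank_map_add_finrank_inf_ker [Finite ι] (ρ : (ι → F) →ₗ[F] (κ → F))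
    (V : Submodule F (ι → F)) :
    Module.finrank F (V.map ρ) + Module.finrank F (V ⊓ LinearMap.ker ρ : Submodule F (ι → F)) =
      Module.finrank F V := by
  rw [← LinearMap.finrank_range_add_finrank_ker (ρ.domRestrict V), LinearMap.range_domRestrict,
    LinearMap.ker_domRestrict, (LinearEquiv.finrank_eq (Submodule.equivMapOfInjective V.subtype
      V.injective_subtype ((LinearMap.ker ρ).comap V.subtype))), Submodule.map_comap_subtype]

end LinearAlgebra

namespace Prog

variable {F : Type*} [Field F] [DecidableEq F] {ι κ : Type}

/-- Compute `clearCoord` of the vector at `u` by the vector at `v`. -/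
noncomputable def reduce [Fintype ι] (p : ι) (v u : ι → ℕ) : Prog (ι → ℕ) :=
  (arith .div (u p) (v p)).andThen fun c =>
    tabulate fun j => (arith .mul c (v j)).andThen fun t => arith .sub (u j) t

lemma Spec.reduce [Fintype ι] {σ : List F} (p : ι) {v u : ι → ℕ} {x y : ι → F}
    (hv : RepVec σ v x) (hu : RepVec σ u y) :
    (Prog.reduce p v u).Spec σ (1 + Fintype.card ι * 2) fun a σ' =>
      RepVec σ' a (clearCoord x p y) := by
  refine (Spec.arith (hu p) (hv p)).andThen fun c σ₁ h₁ hc => ?_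
  refine (Spec.tabulate (Q := fun j a σ' => σ'[a]? = some (clearCoord x p y j))
    (fun j a σ₁ σ₂ h ha => h.getElem?_eq_some ha) fun j σ₂ h₂ => ?_).mono le_rfl
      fun _ _ _ h => h
  refine (Spec.arith (h₂.getElem?_eq_some hc) ((hv.mono (h₁.trans h₂)) j)).andThen
    (c₁ := 1) (c₂ := 1) fun t σ₃ h₃ ht => ?_
  refine (Spec.arith ((hu.mono (h₁.trans (h₂.trans h₃))) j) ht).mono le_rfl fun a σ' _ ha => ?_
  rw [ha, clearCoord_apply]
  simp [ArithOp.eval]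

/-- Gaussian elimination of the coordinates `pos j` from the list `l` of vectors; the vector `d` is
reduced along with them but is never a pivot. The first argument after `z` is recursion fuel and
has to be the length of the list. -/
noncomputable def eliminate [Fintype ι] [Fintype κ] (pos : κ → ι) (z : ℕ) :
    ℕ → List (ι → ℕ) → (ι → ℕ) → Prog (List (ι → ℕ) × (ι → ℕ))
  | 0, l, d => ret (l, d)
  | _ + 1, [], d => ret ([], d)
  | n + 1, v :: l, d =>
    (findNonzero z (fun j => v (pos j)) Finset.univ.toList).andThen fun r =>
      match r with
      | none => (eliminate pos z n l d).andThen fun r' => ret (v :: r'.1, r'.2)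
      | some p =>
        (mapList (reduce (pos p) v) l).andThen fun l' =>
          (reduce (pos p) v d).andThen fun d' => eliminate pos z n l' d'

lemma Spec.eliminate [Fintype ι] [Fintype κ] (pos : κ → ι) {z : ℕ} {σ : List F} {n : ℕ}
    {l : List (ι → ℕ)} {d : ι → ℕ} {xs : List (ι → F)} {δ : ι → F}
    (hz : σ[z]? = some 0) (hl : List.Forall₂ (RepVec σ) l xs) (hd : RepVec σ d δ)
    (hn : l.length = n) :
    (Prog.eliminate pos z n l d).Spec σ
      (n * (Fintype.card κ + n * (1 + Fintype.card ι * 2))) fun r σ' =>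
      ∃ xs' δ', List.Forall₂ (RepVec σ') r.1 xs' ∧ RepVec σ' r.2 δ' ∧
        Eliminated (LinearMap.funLeft F F pos) xs δ xs' δ' := by
  induction n generalizing σ l d xs δ with
  | zero =>
    obtain rfl := List.length_eq_zero_iff.1 hn
    cases hl
    exact (Spec.ret ⟨[], δ, .nil, hd, .nil _ _⟩).mono (by simp) fun _ _ _ h => h
  | succ n ih =>
    cases hl with
    | nil => simp at hn
    | @cons v x l xs hv hl =>
    simp only [List.length_cons, Nat.add_right_cancel_iff] at hn
    refine ((Spec.findNonzero (κ := κ) (x := fun j => x (pos j)) hz (fun j => hv (pos j))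
      Finset.univ.toList).andThen
      (c₂ := (n + 1) * (1 + Fintype.card ι * 2) + n * (Fintype.card κ + n * (1 + Fintype.card ι * 2)))
      fun r σ₁ h₁ hr => ?_).mono ?_ fun _ _ _ h => h
    · cases r with
      | none =>
        have hx : LinearMap.funLeft F F pos x = 0 :=
          funext fun j => hr.1 rfl j (by simp)
        refine ((ih (h₁.getElem?_eq_some hz) (hl.imp fun _ _ h => h.mono h₁) (hd.mono h₁)
          hn).andThen (c₂ := 0) fun r σ₂ h₂ hr' => Spec.ret ?_).mono (by omega) fun _ _ _ h => h
        obtain ⟨xs', δ', hl', hd', hE⟩ := hr'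
        exact ⟨x :: xs', δ', .cons (hv.mono (h₁.trans h₂)) hl', hd', hE.keep hx⟩
      | some p =>
        refine ((Spec.mapList (hl.imp fun _ _ h => h.mono h₁) fun u y σ₂ h₂ hu =>
          Spec.reduce (pos p) (hv.mono (h₁.trans h₂)) hu).andThen fun l' σ₂ h₂ hl' =>
          (Spec.reduce (pos p) (hv.mono (h₁.trans h₂)) (hd.mono (h₁.trans h₂))).andThen
            fun d' σ₃ h₃ hd' => (ih (((h₁.trans h₂).trans h₃).getElem?_eq_some hz)
              (hl'.imp fun _ _ h => h.mono h₃) hd' ?_).mono le_rfl ?_).mono ?_ fun _ _ _ h => h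
        · rw [hl'.length_eq, List.length_map, ← hl.length_eq, hn]
        · rintro r σ' - ⟨xs', δ', hl', hd', hE⟩
          exact ⟨xs', δ', hl', hd', hE.pivot (hr.2 p rfl)⟩
        · rw [hn]; ring_nf; omega
    · rw [Finset.length_toList, Finset.card_univ]
      ring_nf
      nlinarith

end Prog

/-! ### Random pinning of blocks -/

/-- The weight of block `i` in the random choice, where `e` is the dimension of a space `V` and
`D i` the dimension of its subspace that vanishes on block `i`: an upper bound for the number of
list elements in a coset of that subspace, and zero if the block does not lower the dimension. -/
def coordWeight {N : ℕ} (s e : ℕ) (D : Fin N → ℕ) (i : Fin N) : ℕ :=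
  if D i < e then s * D i + 1 else 0

lemma exists_proportional_fibers {N : ℕ} [NeZero N] (w : Fin N → ℕ) (Q : ℕ) :
    ∃ f : Fin Q → Fin N, 0 < ∑ i, w i → ∑ i, w i ∣ Q →
      ∀ i, (Finset.univ.filter fun x => f x = i).card * ∑ i, w i = w i * Q := by
  classical
  by_cases h : 0 < ∑ i, w i ∧ ∑ i, w i ∣ Q
  · obtain ⟨h0, q, rfl⟩ := h
    have hc : Fintype.card (Fin ((∑ i, w i) * q)) = Fintype.card (Σ i, Fin (w i * q)) := by
      simp [Finset.sum_mul]
    let e := Fintype.equivOfCardEq hc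
    refine ⟨fun x => (e x).1, fun _ _ i => ?_⟩
    have : (Finset.univ.filter fun x => (e x).1 = i).card = w i * q := by
      rw [← Fintype.card_subtype, Fintype.card_congr ((e.subtypeEquiv fun _ => Iff.rfl).trans
        (Equiv.sigmaSubtype i))]
      simp
    rw [this]; ring
  · exact ⟨fun _ => 0, fun h0 h1 => (h ⟨h0, h1⟩).elim⟩

/-- A function that maps a uniform draw from `Fin Q` to `i` with probability proportional to `w i`,
provided that `∑ i, w i` is positive and divides `Q`. -/
noncomputable def weightedPick {N Q : ℕ} [NeZero N] (w : Fin N → ℕ) : Fin Q → Fin N :=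
  (exists_proportional_fibers w Q).choose

lemma card_weightedPick {N Q : ℕ} [NeZero N] {w : Fin N → ℕ} (h0 : 0 < ∑ i, w i)
    (hQ : ∑ i, w i ∣ Q) (i : Fin N) :
    (Finset.univ.filter fun x : Fin Q => weightedPick w x = i).card * ∑ i, w i = w i * Q :=
  (exists_proportional_fibers w Q).choose_spec h0 hQ i

section Isolates

variable {F : Type*} [Field F] {N m Q : ℕ}

/-- The dimension of the subspace of `V` that vanishes on block `i`. -/
noncomputable def blockDim (V : Submodule F (Fin N × Fin m → F)) (i : Fin N) : ℕ :=
  Module.finrank F (V ⊓ LinearMap.ker (blockMap F i) : Submodule F (Fin N × Fin m → F))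

/-- The block that the draw `x` selects when the current space is `V`. -/
noncomputable def pickBlock [NeZero N] (s : ℕ) (V : Submodule F (Fin N × Fin m → F))
    (x : Fin Q) : Fin N :=
  weightedPick (coordWeight s (Module.finrank F V) (blockDim V)) x

/-- Pinning the blocks selected by the draws `ω` one after the other, starting from the direction
space `V`, ends with the zero space, and the error word `ε` vanishes on each pinned block. The run
then ends with the codeword whose difference from the received word is `ε`. -/
def Isolates [NeZero N] (s : ℕ) (ε : Fin N × Fin m → F) :
    List (Fin Q) → Submodule F (Fin N × Fin m → F) → Prop
  | [], V => V = ⊥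
  | x :: ω, V => V = ⊥ ∨ (blockMap F (pickBlock s V x) ε = 0 ∧
      Isolates s ε ω (V ⊓ LinearMap.ker (blockMap F (pickBlock s V x))))

end Isolates

namespace Prog

variable {F : Type*} [Field F] [DecidableEq F] {N m Q : ℕ}

/-- Compute `blockDim` for all blocks. Each elimination works on a single block, so that all of them
together cost no more than a few passes over the whole word. -/
noncomputable def blockDims (z : ℕ) (l : List (Fin N × Fin m → ℕ)) (d : Fin N × Fin m → ℕ) :
    Prog (Fin N → ℕ) :=
  tabulate fun i => (eliminate (id : Fin m → Fin m) z l.length (l.map fun v j => v (i, j))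
    fun j => d (i, j)).andThen fun r => ret r.1.length

lemma Spec.blockDims {z : ℕ} {σ : List F} {l : List (Fin N × Fin m → ℕ)}
    {d : Fin N × Fin m → ℕ} {xs : List (Fin N × Fin m → F)} {δ : Fin N × Fin m → F}
    (hz : σ[z]? = some 0) (hl : List.Forall₂ (RepVec σ) l xs) (hd : RepVec σ d δ)
    (hxs : Module.finrank F (listSpan xs) = xs.length) :
    (Prog.blockDims z l d).Spec σ (N * (l.length * (m + l.length * (1 + m * 2)))) fun D _ =>
      D = blockDim (listSpan xs) := by
  refine (Spec.tabulate (Q := fun i (a : ℕ) (_ : List F) => a = blockDim (listSpan xs) i)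
    (c := l.length * (m + l.length * (1 + m * 2)))
    (fun _ _ _ _ _ h => h) fun i σ₁ h₁ => ?_).mono (by simp) fun _ _ _ h => funext h
  have hl' : List.Forall₂ (RepVec σ₁) (l.map fun v j => v (i, j)) (xs.map (blockMap F i)) := by
    rw [List.forall₂_map_left_iff, List.forall₂_map_right_iff]
    exact hl.imp fun v x h j => (h.mono h₁) (i, j)
  refine ((Spec.eliminate id (h₁.getElem?_eq_some hz) hl' (δ := fun j => δ (i, j))
    (fun j => (hd.mono h₁) (i, j)) (by simp)).andThen (c₂ := 0) fun r σ₂ h₂ hr =>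
      Spec.ret ?_).mono (by simp) fun _ _ _ h => h
  obtain ⟨xs', δ', hl'', -, hE⟩ := hr
  have h1 := hE.length_add
  have hid : LinearMap.funLeft F F (id : Fin m → Fin m) = LinearMap.id := rfl
  rw [hid, Submodule.map_id, listSpan_map, List.length_map, ← hxs,
    ← finrank_map_add_finrank_inf_ker (blockMap F i)] at h1
  rw [hl''.length_eq, blockDim]
  omega

/-- Pin the blocks selected by the draws, and return the positions of the remaining error word. The
list `l` holds a basis of the direction space and `d` the difference between the received word and
a point of the affine space. -/
noncomputable def prune [NeZero N] (s z : ℕ) : List (Fin Q) → List (Fin N × Fin m → ℕ) →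
    (Fin N × Fin m → ℕ) → Prog (Fin N × Fin m → ℕ)
  | [], _, d => ret d
  | _ :: _, [], d => ret d
  | x :: ω, v :: l, d =>
    (blockDims z (v :: l) d).andThen fun D =>
      (eliminate (fun j => (weightedPick (coordWeight s (v :: l).length D) x, j)) z
        (v :: l).length (v :: l) d).andThen fun r => prune s z ω r.1 r.2

lemma prune_cost_le {s m N e : ℕ} (hs : 1 ≤ s) (hm : 1 ≤ m) (hN : 1 ≤ N) (he : e ≤ s) :
    N * (e * (m + e * (1 + m * 2))) + e * (m + e * (1 + N * m * 2)) ≤ 8 * s ^ 2 * (m * N) := by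
  have h1 : m + e * (1 + m * 2) ≤ 4 * (s * m) := by
    have : e * (1 + m * 2) ≤ s * (3 * m) := Nat.mul_le_mul he (by omega)
    nlinarith
  have hmN : 1 ≤ N * m := Nat.mul_pos hN hm
  have h2 : m + e * (1 + N * m * 2) ≤ 4 * (s * (N * m)) := by
    have : e * (1 + N * m * 2) ≤ s * (3 * (N * m)) := Nat.mul_le_mul he (by omega)
    have h3 : m ≤ s * (N * m) := by
      calc m = 1 * (1 * m) := by ring
        _ ≤ s * (N * m) := Nat.mul_le_mul hs (Nat.mul_le_mul_right _ hN)
    nlinarith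
  calc _ ≤ N * (s * (4 * (s * m))) + s * (4 * (s * (N * m))) :=
        Nat.add_le_add (Nat.mul_le_mul_left _ (Nat.mul_le_mul he h1)) (Nat.mul_le_mul he h2)
    _ = 8 * s ^ 2 * (m * N) := by ring

lemma Spec.prune [NeZero N] {s z : ℕ} (hs : 1 ≤ s) (hm : 1 ≤ m) {σ : List F} (ω : List (Fin Q))
    {l : List (Fin N × Fin m → ℕ)}
    {d : Fin N × Fin m → ℕ} {xs : List (Fin N × Fin m → F)} {δ : Fin N × Fin m → F}
    (hz : σ[z]? = some 0) (hl : List.Forall₂ (RepVec σ) l xs) (hd : RepVec σ d δ)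
    (hxs : Module.finrank F (listSpan xs) = xs.length) (hle : xs.length ≤ s) :
    (Prog.prune s z ω l d).Spec σ (ω.length * (8 * s ^ 2 * (m * N))) fun r σ' =>
      ∃ δ', RepVec σ' r δ' ∧ δ' - δ ∈ listSpan xs ∧
        ∀ ε, ε - δ ∈ listSpan xs → Isolates s ε ω (listSpan xs) → δ' = ε := by
  induction ω generalizing σ l d xs δ with
  | nil =>
    refine (Spec.ret ⟨δ, hd, by simp, fun ε hε h => ?_⟩).mono (by simp) fun _ _ _ h => h
    rw [Isolates] at h
    rw [h, Submodule.mem_bot, sub_eq_zero] at hε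
    exact hε.symm
  | cons x ω ih =>
    cases hl with
    | nil =>
      refine (Spec.ret ⟨δ, hd, by simp, fun ε hε h => ?_⟩).mono (by simp) fun _ _ _ h => h
      rw [listSpan_nil, Submodule.mem_bot, sub_eq_zero] at hε
      exact hε.symm
    | @cons v y l ys hv hl =>
      have hl : List.Forall₂ (RepVec σ) (v :: l) (y :: ys) := .cons hv hl
      have hlen := hl.length_eq
      have hne : listSpan (y :: ys) ≠ ⊥ := fun h0 => by
        rw [h0, finrank_bot] at hxs
        simp at hxs
      refine ((Spec.blockDims hz hl hd hxs).andThen fun D σ₁ h₁ hD =>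
        (Spec.eliminate _ (h₁.getElem?_eq_some hz) (hl.imp fun _ _ h => h.mono h₁)
          (hd.mono h₁) rfl).andThen (c₂ := ω.length * (8 * s ^ 2 * (m * N)))
          fun r σ₂ h₂ hr => ?_).mono ?_ fun _ _ _ h => h
      · obtain ⟨xs', δ', hl', hd', hE⟩ := hr
        have hpick : weightedPick (coordWeight s (v :: l).length D) x =
            pickBlock s (listSpan (y :: ys)) x := by
          rw [pickBlock, hD, hxs, hlen]
        rw [hpick] at hE
        have hE : Eliminated (blockMap F (pickBlock s (listSpan (y :: ys)) x))
          (y :: ys) δ xs' δ' := hE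
        have hfin : Module.finrank F (listSpan xs') = xs'.length := by
          have h1 := hE.length_add
          rw [← hxs, ← finrank_map_add_finrank_inf_ker
            (blockMap F (pickBlock s (listSpan (y :: ys)) x)), ← hE.span_eq] at h1
          omega
        have hle' : xs'.length ≤ s := by
          have := hE.length_add
          omega
        refine (ih ((h₁.trans h₂).getElem?_eq_some hz) hl' hd' hfin hle').mono le_rfl ?_
        rintro a σ₃ - ⟨δ'', hd'', hmem, hiso⟩
        refine ⟨δ'', hd'', ?_, fun ε hε h => ?_⟩
        · rw [hE.span_eq] at hmem
          rw [show δ'' - δ = (δ'' - δ') + (δ' - δ) by abel]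
          exact Submodule.add_mem _ hmem.1 hE.sub_mem
        · rw [Isolates] at h
          obtain ⟨h0, hω⟩ := h.resolve_left hne
          rw [← hE.span_eq] at hω
          exact hiso ε (hE.sub_mem_of_map_eq_zero ε hε h0) hω
      · have := prune_cost_le hs hm (Nat.pos_of_neZero N) (hlen.trans_le hle)
        simp only [Fintype.card_prod, Fintype.card_fin]
        rw [List.length_cons (as := ω), Nat.add_mul, one_mul]
        omega

end Prog

/-! ### Counting the seeds that isolate a codeword -/

section Counting

variable {F : Type*} [Field F] {N m Q : ℕ}

/-- A seed isolates at most one word of an affine space. -/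
lemma Isolates.unique [NeZero N] {s : ℕ} {ω : List (Fin Q)} {V : Submodule F (Fin N × Fin m → F)}
    {ε ε' : Fin N × Fin m → F} (h : Isolates s ε ω V) (h' : Isolates s ε' ω V)
    (hV : ε - ε' ∈ V) : ε = ε' := by
  induction ω generalizing V with
  | nil =>
    rw [Isolates] at h
    rwa [h, Submodule.mem_bot, sub_eq_zero] at hV
  | cons x ω ih =>
    rw [Isolates] at h h'
    by_cases hbot : V = ⊥
    · rwa [hbot, Submodule.mem_bot, sub_eq_zero] at hV
    · obtain ⟨h0, h⟩ := h.resolve_left hbot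
      obtain ⟨h0', h'⟩ := h'.resolve_left hbot
      exact ih h h' ⟨hV, LinearMap.mem_ker.2 (by rw [map_sub, h0, h0', sub_self])⟩

/-- All words in `V` are folded evaluations of polynomials of degree less than `k`. -/
def IsFoldedEval (k : ℕ) (γ : F) (V : Submodule F (Fin N × Fin m → F)) : Prop :=
  ∀ v ∈ V, ∃ f : Polynomial F, f.degree < k ∧
    ∀ i j, v (i, j) = f.eval (γ ^ (m * (i : ℕ) + (j : ℕ)))

open Classical in
/-- The sequences of `r` draws that isolate `ε` in `V`. -/
noncomputable def isolatingSeeds [NeZero N] (s r Q : ℕ) (ε : Fin N × Fin m → F)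
    (V : Submodule F (Fin N × Fin m → F)) : Finset (Fin r → Fin Q) :=
  Finset.univ.filter fun ω => Isolates s ε (List.ofFn ω) V

lemma card_isolatingSeeds_succ [NeZero N] [DecidableEq F] {s r : ℕ} (ε : Fin N × Fin m → F)
    {V : Submodule F (Fin N × Fin m → F)} (hV : V ≠ ⊥) :
    (isolatingSeeds s (r + 1) Q ε V).card =
      ∑ x : Fin Q, if blockMap F (pickBlock s V x) ε = 0 then
        (isolatingSeeds s r Q ε (V ⊓ LinearMap.ker (blockMap F (pickBlock s V x)))).card else 0 := by
  classical
  have h1 : (isolatingSeeds s (r + 1) Q ε V).card =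
      Fintype.card {p : Fin Q × (Fin r → Fin Q) // blockMap F (pickBlock s V p.1) ε = 0 ∧
        Isolates s ε (List.ofFn p.2) (V ⊓ LinearMap.ker (blockMap F (pickBlock s V p.1)))} := by
    rw [isolatingSeeds, ← Fintype.card_subtype]
    refine (Fintype.card_congr ((Fin.consEquiv fun _ => Fin Q).subtypeEquiv fun p => ?_)).symm
    rw [show (Fin.consEquiv fun _ => Fin Q) p = Fin.cons p.1 p.2 from rfl, List.ofFn_cons, Isolates]
    simp [hV]
  rw [h1, Fintype.card_subtype, Finset.card_filter, Fintype.sum_prod_type]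
  refine Finset.sum_congr rfl fun x _ => ?_
  split_ifs with h
  · rw [isolatingSeeds, Finset.card_filter]
    exact Finset.sum_congr rfl fun y _ => by simp [h]
  · simp [h]

/-- The numerical core of the isolation bound: `D` is the sum of the dimensions over all `n` blocks,
bounded by the subspace design property, and `a` is the number of blocks of agreement. -/
lemma sum_weight_le {s e κ k D n a : ℕ} (he : 1 ≤ e) (hk : k ≤ κ * n)
    (hκ : 0 < κ) (hD : D * κ ≤ e * k) (ha : κ * n + s * k < (s + 1) * κ * a) :
    s * D + n ≤ a * (s * e + 1) := by
  obtain ⟨e, rfl⟩ := Nat.exists_eq_add_of_le' he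
  have hpos : 0 < κ * (s + 1) := by positivity
  refine Nat.le_of_mul_le_mul_left ?_ hpos
  zify at *
  have h1 : (κ * n + s * k : ℤ) * (s * (e + 1) + 1) ≤ (s + 1) * κ * a * (s * (e + 1) + 1) :=
    mul_le_mul_of_nonneg_right ha.le (by positivity)
  have h2 : (s * (s + 1) : ℤ) * (D * κ) ≤ s * (s + 1) * ((e + 1) * k) :=
    mul_le_mul_of_nonneg_left hD (by positivity)
  have h3 : 0 ≤ (s * e : ℤ) * (κ * n - k) := mul_nonneg (by positivity) (by linarith)
  nlinarith

/-- Each list element is isolated with probability at least `1 / (s * finrank V + 1)`. The weights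
are reciprocal to the bound for the next space, so the weighted mean of the bounds over the blocks
of agreement counts these blocks, up to the total weight. Blocks that do not lower the dimension
contribute the same amount to both sides of the remaining inequality `sum_weight_le`. -/
theorem pow_le_card_isolatingSeeds [NeZero N] [DecidableEq F] {s κ k : ℕ} {γ : F} (hκ : 0 < κ)
    (hm : κ + s = m + 1) (hk : k < κ * N) (hkn : k ≤ m * N) (hγ : m * N ≤ orderOf γ)
    (hQ : ∀ W, 0 < W → W ≤ N * (s * s + 1) → W ∣ Q) (ε : Fin N × Fin m → F)
    (hε : κ * N + s * k < (s + 1) * κ *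
      (Finset.univ.filter fun i : Fin N => blockMap F i ε = 0).card)
    (r : ℕ) (V : Submodule F (Fin N × Fin m → F)) (hV : IsFoldedEval k γ V)
    (hs : Module.finrank F V ≤ s) (hr : Module.finrank F V ≤ r) :
    Q ^ r ≤ (isolatingSeeds s r Q ε V).card * (s * Module.finrank F V + 1) := by
  classical
  induction r generalizing V with
  | zero =>
    have h0 : V = ⊥ := Submodule.finrank_eq_zero.1 (Nat.le_zero.1 hr)
    subst h0
    simp [isolatingSeeds, Isolates]
  | succ r ih =>
    by_cases h0 : V = ⊥
    · subst h0
      simp [isolatingSeeds, Isolates, List.ofFn_succ]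
    set e := Module.finrank F V with he
    have he1 : 1 ≤ e := Nat.one_le_iff_ne_zero.2 fun h => h0 (Submodule.finrank_eq_zero.1 h)
    set D := blockDim V
    set w := coordWeight s e D with hw
    set W := ∑ i, w i
    set A := Finset.univ.filter fun i : Fin N => blockMap F i ε = 0
    have hDe : ∀ i, D i ≤ e := fun i => Submodule.finrank_mono inf_le_left
    have hdesign : (∑ i, D i) * κ ≤ e * k := by
      refine le_trans (Nat.mul_le_mul_left _ ?_)
        (sum_finrank_inf_ker_blockMap_le hkn hγ V hV (by omega))
      rw [← he]; omega
    -- Some block lowers the dimension, because `k < κ * N`.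
    have hWpos : 0 < W := by
      by_contra hW
      have hW0 : W = 0 := by omega
      have hall : ∀ i, D i = e := fun i => by
        have := Finset.sum_eq_zero_iff.1 hW0 i (Finset.mem_univ i)
        rw [hw, coordWeight] at this
        split_ifs at this with hlt
        exact le_antisymm (hDe i) (not_lt.1 hlt)
      rw [Finset.sum_congr rfl fun i _ => hall i] at hdesign
      simp only [Finset.sum_const, Finset.card_univ, Fintype.card_fin, smul_eq_mul] at hdesign
      have : e * k < e * (κ * N) := Nat.mul_lt_mul_of_pos_left hk he1
      nlinarith
    have hwle : ∀ i, w i ≤ s * s + 1 := fun i => by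
      rw [hw, coordWeight]
      split_ifs
      · exact Nat.succ_le_succ (Nat.mul_le_mul_left _ ((hDe i).trans hs))
      · exact Nat.zero_le _
    have hWQ : W ∣ Q := hQ W hWpos <| by
      simpa using Finset.sum_le_card_nsmul Finset.univ w _ fun i _ => hwle i
    -- `B` consists of the blocks that do not lower the dimension.
    set B := Finset.univ.filter fun i : Fin N => ¬ D i < e
    have hWsum : W + B.card * (s * e + 1) = s * ∑ i, D i + N := by
      have : ∀ i, w i + (if ¬ D i < e then s * e + 1 else 0) = s * D i + 1 := fun i => by
        rw [hw, coordWeight]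
        split_ifs with h
        · rfl
        · rw [le_antisymm (hDe i) (not_lt.1 h)]; omega
      have h2 := Finset.sum_congr (rfl : (Finset.univ : Finset (Fin N)) = _) fun i _ => this i
      rw [Finset.sum_add_distrib, Finset.sum_add_distrib, ← Finset.sum_filter, ← Finset.mul_sum] at h2
      simpa [B, W] using h2
    have hAB : W ≤ (A \ B).card * (s * e + 1) := by
      have h1 := sum_weight_le he1 hk.le hκ hdesign hε
      have h2 : A.card ≤ (A \ B).card + B.card := by
        have := Finset.le_card_sdiff B A
        omega
      have h3 := Nat.mul_le_mul_right (s * e + 1) h2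
      rw [Nat.add_mul] at h3
      omega
    rw [card_isolatingSeeds_succ ε h0]
    -- Group the draws by the block that they select.
    have hgroup : ∑ i ∈ A \ B, (Finset.univ.filter fun x : Fin Q => pickBlock s V x = i).card *
        (isolatingSeeds s r Q ε (V ⊓ LinearMap.ker (blockMap F i))).card ≤
        ∑ x : Fin Q, if blockMap F (pickBlock s V x) ε = 0 then
          (isolatingSeeds s r Q ε (V ⊓ LinearMap.ker (blockMap F (pickBlock s V x)))).card
          else 0 := by
      rw [← Finset.sum_fiberwise (s := Finset.univ) (g := fun x : Fin Q => pickBlock s V x)]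
      refine (Finset.sum_le_sum fun i hi => ?_).trans
        (Finset.sum_le_sum_of_subset (Finset.subset_univ (A \ B)))
      rw [← smul_eq_mul, ← Finset.sum_const]
      refine Finset.sum_le_sum fun x hx => ?_
      have hx := (Finset.mem_filter.1 hx).2
      have hi := (Finset.mem_filter.1 (Finset.mem_sdiff.1 hi).1).2
      subst hx
      rw [if_pos hi]
    have hterm : ∀ i ∈ A \ B, Q * Q ^ r ≤
        W * ((Finset.univ.filter fun x : Fin Q => pickBlock s V x = i).card *
        (isolatingSeeds s r Q ε (V ⊓ LinearMap.ker (blockMap F i))).card) := fun i hi => by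
      have hlt : D i < e := by
        by_contra h
        exact (Finset.mem_sdiff.1 hi).2 (by simpa [B] using h)
      have hcard : (Finset.univ.filter fun x : Fin Q => pickBlock s V x = i).card * W =
          (s * D i + 1) * Q := by
        have := card_weightedPick (Q := Q) hWpos hWQ i
        rwa [show w i = s * D i + 1 by rw [hw, coordWeight, if_pos hlt]] at this
      have hi := ih (V ⊓ LinearMap.ker (blockMap F i)) (fun v hv => hV v hv.1)
        (hlt.le.trans hs) (Nat.le_of_lt_succ (hlt.trans_le hr))
      calc Q * Q ^ r ≤ Q * ((isolatingSeeds s r Q ε (V ⊓ LinearMap.ker (blockMap F i))).card *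
            (s * D i + 1)) := Nat.mul_le_mul_left _ hi
        _ = ((s * D i + 1) * Q) *
            (isolatingSeeds s r Q ε (V ⊓ LinearMap.ker (blockMap F i))).card := by ring
        _ = _ := by rw [← hcard]; ring
    have hsum := Finset.sum_le_sum hterm
    rw [Finset.sum_const, smul_eq_mul, ← Finset.mul_sum] at hsum
    refine Nat.le_of_mul_le_mul_left ?_ hWpos
    calc W * Q ^ (r + 1) ≤ ((A \ B).card * (s * e + 1)) * (Q * Q ^ r) := by
          rw [pow_succ' Q r]; exact Nat.mul_le_mul_right _ hAB
      _ = ((A \ B).card * (Q * Q ^ r)) * (s * e + 1) := by ring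
      _ ≤ (W * _) * (s * e + 1) := Nat.mul_le_mul_right _
          (hsum.trans (Nat.mul_le_mul_left _ hgroup))
      _ = _ := by ring

end Counting

/-! ### Probability of success -/

namespace CompTree

variable {α : Type} {F : Type*} [Field F] [DecidableEq F]

/-- Draw a uniform element of `X` and go on with the tree it selects. -/
noncomputable def drawThen (X : Type) [Fintype X] [Nonempty X] (f : X → CompTree α) : CompTree α :=
  rand (Fintype.card X - 1) fun i => f ((Fintype.equivFinOfCardEq
    (Nat.sub_add_cancel (Fintype.card_pos (α := X))).symm).symm i)

lemma worstOps_drawThen_le {X : Type} [Fintype X] [Nonempty X] {f : X → CompTree α} {σ : List F}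
    {c : ℕ} (h : ∀ x, (f x).worstOps σ ≤ c) : (drawThen X f).worstOps σ ≤ c :=
  Finset.sup_le fun _ _ => h _

lemma card_div_card_le_run_drawThen {X : Type} [Fintype X] [Nonempty X] {f : X → CompTree α}
    {σ : List F} {E : Set (α × List F)} (G : Finset X)
    (h : ∀ x ∈ G, ∀ o ∈ ((f x).run σ).support, o ∈ E) :
    (G.card : ENNReal) / Fintype.card X ≤ ((drawThen X f).run σ).toOuterMeasure E := by
  classical
  have hc := Nat.sub_add_cancel (Fintype.card_pos (α := X))
  set e := (Fintype.equivFinOfCardEq hc.symm).symm with he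
  rw [drawThen, run, PMF.toOuterMeasure_bind_apply, tsum_fintype]
  calc (G.card : ENNReal) / Fintype.card X
      = ∑ i ∈ G.map e.symm.toEmbedding, (Fintype.card X : ENNReal)⁻¹ := by
        rw [Finset.sum_const, Finset.card_map, nsmul_eq_mul, div_eq_mul_inv]
    _ ≤ ∑ i ∈ G.map e.symm.toEmbedding,
          (PMF.uniformOfFintype (Fin (Fintype.card X - 1 + 1))) i *
            ((f (e i)).run σ).toOuterMeasure E := by
        refine Finset.sum_le_sum fun i hi => ?_
        obtain ⟨x, hx, rfl⟩ := Finset.mem_map.1 hi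
        have h1 : ((f x).run σ).toOuterMeasure E = 1 :=
          (PMF.toOuterMeasure_apply_eq_one_iff _ _).2 fun o ho => h x hx o ho
        simp only [Equiv.coe_toEmbedding, Equiv.apply_symm_apply, h1, mul_one,
          PMF.uniformOfFintype_apply, Fintype.card_fin, hc, le_refl]
    _ ≤ _ := Finset.sum_le_sum_of_subset (Finset.subset_univ _)

end CompTree

lemma le_toOuterMeasure_bind {α β : Type*} {p : PMF α} {f : α → PMF β} {E : Set β} {q : ENNReal}
    (h : ∀ a ∈ p.support, q ≤ (f a).toOuterMeasure E) : q ≤ (p.bind f).toOuterMeasure E := by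
  rw [PMF.toOuterMeasure_bind_apply]
  calc q = ∑' a, p a * q := by rw [ENNReal.tsum_mul_right, p.tsum_coe, one_mul]
    _ ≤ _ := ENNReal.tsum_le_tsum fun a => by
      by_cases ha : a ∈ p.support
      · exact mul_le_mul_right (h a ha) _
      · rw [PMF.mem_support_iff, not_not] at ha
        simp [ha]

/-- Let `G w` be disjoint events of probability at least `1 / M`. Then there are at most `M` of them,
and by a union bound `t` independent draws meet all of them with probability at least
`1 - M * exp (-t / M)`. -/
lemma exists_covering_finset {Ω ι : Type*} [Fintype Ω] [DecidableEq Ω] [Nonempty Ω]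
    (L : Finset ι)
    (G : ι → Finset Ω) {M : ℕ} (t : ℕ) (hM : 0 < M)
    (hG : ∀ w ∈ L, Fintype.card Ω ≤ (G w).card * M)
    (hdisj : (L : Set ι).PairwiseDisjoint G) :
    ∃ H : Finset (Fin t → Ω),
      (1 - M * Real.exp (-(t / M))) * Fintype.card (Fin t → Ω) ≤ H.card ∧
      ∀ ζ ∈ H, ∀ w ∈ L, ∃ j, ζ j ∈ G w := by
  classical
  refine ⟨Finset.univ.filter fun ζ => ∀ w ∈ L, ∃ j, ζ j ∈ G w, ?_,
    fun ζ hζ => (Finset.mem_filter.1 hζ).2⟩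
  have hΩ : (0 : ℝ) < Fintype.card Ω := by exact_mod_cast Fintype.card_pos
  have hM' : (0 : ℝ) < M := by exact_mod_cast hM
  have hL : L.card ≤ M := by
    have h1 : ∑ w ∈ L, (G w).card ≤ Fintype.card Ω := by
      rw [← Finset.card_biUnion hdisj]
      exact Finset.card_le_univ _
    have h2 := Finset.sum_le_sum hG
    rw [Finset.sum_const, smul_eq_mul, ← Finset.sum_mul] at h2
    have h3 := h2.trans (Nat.mul_le_mul_right M h1)
    rw [mul_comm] at h3
    exact Nat.le_of_mul_le_mul_left h3 Fintype.card_pos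
  set bad : ι → Finset (Fin t → Ω) := fun w => Fintype.piFinset fun _ => (G w)ᶜ with hbad
  have hbadle : ∀ w ∈ L, ((bad w).card : ℝ) ≤
      Real.exp (-(t / M)) * Fintype.card (Fin t → Ω) := fun w hw => by
    have h1 : ((G w)ᶜ.card : ℝ) ≤ Real.exp (-(1 / M)) * Fintype.card Ω := by
      rw [Finset.card_compl, Nat.cast_sub (Finset.card_le_univ _)]
      have h2 : (Fintype.card Ω : ℝ) ≤ (G w).card * M := by exact_mod_cast hG w hw
      have h3 : (Fintype.card Ω : ℝ) / M ≤ (G w).card := (div_le_iff₀ hM').2 h2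
      have h4 := Real.one_sub_le_exp_neg (1 / (M : ℝ))
      calc (Fintype.card Ω : ℝ) - (G w).card ≤ (1 - 1 / M) * Fintype.card Ω := by
            rw [sub_mul, one_mul, one_div_mul_eq_div]; linarith
        _ ≤ _ := mul_le_mul_of_nonneg_right h4 hΩ.le
    rw [hbad, Fintype.card_piFinset_const, Fintype.card_fun, Fintype.card_fin]
    push_cast
    calc ((G w)ᶜ.card : ℝ) ^ t ≤ (Real.exp (-(1 / M)) * Fintype.card Ω) ^ t :=
          pow_le_pow_left₀ (by positivity) h1 t
      _ = _ := by
          rw [mul_pow, ← Real.exp_nat_mul]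
          congr 2
          ring
  have hcover : (Finset.univ : Finset (Fin t → Ω)) ⊆
      (Finset.univ.filter fun ζ : Fin t → Ω => ∀ w ∈ L, ∃ j, ζ j ∈ G w) ∪ L.biUnion bad := by
    intro ζ _
    by_cases h : ∀ w ∈ L, ∃ j, ζ j ∈ G w
    · exact Finset.mem_union_left _ (Finset.mem_filter.2 ⟨Finset.mem_univ _, h⟩)
    · push Not at h
      obtain ⟨w, hw, hj⟩ := h
      refine Finset.mem_union_right _ (Finset.mem_biUnion.2 ⟨w, hw, ?_⟩)
      simpa [hbad, Fintype.mem_piFinset] using hj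
  have h5 : (Fintype.card (Fin t → Ω) : ℝ) ≤
      (Finset.univ.filter fun ζ : Fin t → Ω => ∀ w ∈ L, ∃ j, ζ j ∈ G w).card +
        ∑ w ∈ L, ((bad w).card : ℝ) := by
    have := (Finset.card_le_card hcover).trans ((Finset.card_union_le _ _).trans
      (Nat.add_le_add_left Finset.card_biUnion_le _))
    rw [Finset.card_univ] at this
    exact_mod_cast this
  have h6 : ∑ w ∈ L, ((bad w).card : ℝ) ≤
      M * (Real.exp (-(t / M)) * Fintype.card (Fin t → Ω)) := by
    refine (Finset.sum_le_sum hbadle).trans ?_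
    rw [Finset.sum_const, nsmul_eq_mul]
    exact mul_le_mul_of_nonneg_right (by exact_mod_cast hL) (by positivity)
  linarith

/-! ### The decoding program -/

section Words

variable {F : Type*} [Field F] {m N : ℕ}

/-- The tape `σ` holds the word `w` at the positions `a`. -/
abbrev RepWord (σ : List F) (a : AddrWord m N) (w : FWord F m N) : Prop :=
  RepVec σ (Function.uncurry a) (Function.uncurry w)

lemma RepWord.read_eq {σ : List F} {a : AddrWord m N} {w : FWord F m N} (h : RepWord σ a w) :
    a.read σ = w := by
  funext i j
  have := h (i, j)
  simp only [Function.uncurry] at this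
  simp [AddrWord.read, List.getD_eq_getElem?_getD, this]

lemma outputSet_eq_of_forall₂ {σ : List F} {as : List (AddrWord m N)} {ws : List (FWord F m N)}
    (h : List.Forall₂ (RepWord σ) as ws) : outputSet (as, σ) = {w | w ∈ ws} := by
  induction h with
  | nil => simp [outputSet]
  | cons ha _ ih =>
    ext w
    have : (∃ a ∈ _, AddrWord.read a σ = w) ↔ w ∈ _ := Set.ext_iff.1 ih w
    change (∃ a ∈ _ :: _, AddrWord.read a σ = w) ↔ w ∈ _ :: _
    rw [List.exists_mem_cons_iff, this, ha.read_eq, List.mem_cons, eq_comm]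
    exact Iff.rfl

/-- The positions of the received word on the input tape. -/
def inputAddr (m N : ℕ) : AddrWord m N := fun i j => 2 + (m * (i : ℕ) + (j : ℕ))

lemma inputTape_eq (γ : F) (g : FWord F m N) :
    inputTape γ g = 1 :: γ :: List.ofFn fun p : Fin (N * m) =>
      g (finProdFinEquiv.symm p).1 (finProdFinEquiv.symm p).2 := by
  rw [inputTape, List.ofFn_mul]
  congr 4
  funext i
  congr 1
  funext j
  have : (⟨i * m + j, by
      calc (i : ℕ) * m + j < (i + 1) * m := by rw [Nat.add_mul, one_mul]; omega
        _ ≤ N * m := Nat.mul_le_mul_right _ i.2⟩ : Fin (N * m)) = finProdFinEquiv (i, j) := by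
    ext
    simp [finProdFinEquiv]; ring
  rw [this, Equiv.symm_apply_apply]

lemma length_inputTape (γ : F) (g : FWord F m N) : (inputTape γ g).length = 2 + m * N := by
  rw [inputTape_eq]
  simp only [List.length_cons, List.length_ofFn]
  ring

lemma repWord_inputTape (γ : F) (g : FWord F m N) :
    RepWord (inputTape γ g) (inputAddr m N) g := by
  rintro ⟨i, j⟩
  have h : inputAddr m N i j = (finProdFinEquiv (i, j) : Fin (N * m)).1 + 1 + 1 := by
    simp [inputAddr, finProdFinEquiv]; ring
  rw [inputTape_eq, Function.uncurry, Function.uncurry, h, List.getElem?_cons_succ,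
    List.getElem?_cons_succ, List.getElem?_ofFn, dif_pos (Fin.is_lt _)]
  simp only [Fin.eta, Equiv.symm_apply_apply]

/-- Positions beyond a tape of length `n` read as zero, but would change their value when the tape
is extended; they are replaced by a position `z` that holds zero. -/
def redirectAddr (n z a : ℕ) : ℕ := if a < n then a else z

lemma repVec_redirectAddr {σ σ' : List F} (h : σ <+: σ') {z : ℕ} (hz : σ'[z]? = some 0)
    (a : AddrWord m N) :
    RepVec σ' (fun p : Fin N × Fin m => redirectAddr σ.length z (a p.1 p.2))
      (Function.uncurry (a.read σ)) := by
  rintro ⟨i, j⟩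
  simp only [redirectAddr, Function.uncurry, AddrWord.read]
  split_ifs with hlt
  · exact h.getElem?_eq_some (by simp [hlt])
  · rw [hz, List.getD_eq_default _ _ (not_lt.1 hlt)]

end Words

namespace Prog

variable {F : Type*} [Field F] [DecidableEq F] {N m Q : ℕ}

/-- Output the difference of the words at `a` and `d` if the latter has few nonzero symbols, that is,
if that difference is close to the word at `a`. -/
noncomputable def verify (η : ℝ) (z : ℕ) (a : AddrWord m N) (d : Fin N × Fin m → ℕ) :
    Prog (List (AddrWord m N)) :=
  (tabulate fun i : Fin N => (findNonzero z (fun j : Fin m => d (i, j)) Finset.univ.toList).andThen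
    fun r => ret r.isSome).andThen fun B =>
  if ((Finset.univ.filter fun i => B i = true).card : ℝ) / N < η then
    (tabulate fun p => arith .sub (Function.uncurry a p) (d p)).andThen fun w =>
      ret [Function.curry w]
  else ret []

lemma Spec.verify {η : ℝ} {z : ℕ} {σ : List F} {a : AddrWord m N} {d : Fin N × Fin m → ℕ}
    {g : FWord F m N} {δ : Fin N × Fin m → F}
    (hz : σ[z]? = some 0) (ha : RepWord σ a g) (hd : RepVec σ d δ) :
    (Prog.verify η z a d).Spec σ (2 * (m * N)) fun r σ' =>
      ∃ ws, List.Forall₂ (RepWord σ') r ws ∧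
        ∀ w, w ∈ ws ↔ w = g - Function.curry δ ∧ relDist g w < η := by
  refine ((Spec.tabulate (ι := Fin N) (c := m)
    (Q := fun i (b : Bool) (_ : List F) => (b = true ↔ blockMap F i δ ≠ 0))
    (fun _ _ _ _ _ h => h) fun i σ₁ h₁ => ?_).andThen (c₂ := N * m)
      fun B σ₂ h₂ hB => ?_).mono (by simp; ring_nf; omega) fun _ _ _ h => h
  · refine ((Spec.findNonzero (x := fun j : Fin m => δ (i, j)) (h₁.getElem?_eq_some hz)
      (fun j => (hd.mono h₁) (i, j)) _).andThen (c₂ := 0) fun r σ₂ h₂ hr =>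
        Spec.ret ?_).mono (by simp) fun _ _ _ h => h
    cases r with
    | none =>
      have : blockMap F i δ = 0 := funext fun j => hr.1 rfl j (by simp)
      simp [this]
    | some p =>
      have : blockMap F i δ ≠ 0 := fun h => hr.2 p rfl (congrFun h p)
      simp [this]
  · have hdist : ((Finset.univ.filter fun i => B i = true).card : ℝ) / N =
        relDist g (g - Function.curry δ) := by
      rw [relDist, hammingDist]
      congr 3
      ext i
      simp only [Finset.mem_filter, Finset.mem_univ, true_and, hB i, not_iff_not]
      rw [Pi.sub_apply, eq_comm (a := g i), sub_eq_self]
      rfl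
    rw [hdist]
    split_ifs with h
    · refine ((Spec.tabulate (Q := fun p a σ' => σ'[a]? = some (Function.uncurry g p - δ p))
        (fun j a σ₁ σ₂ h ha => h.getElem?_eq_some ha) fun p σ₃ h₃ =>
        (Spec.arith ((ha.mono (h₂.trans h₃)) p) ((hd.mono (h₂.trans h₃)) p))).andThen
        (c₂ := 0) fun w σ₃ h₃ hw =>
        Spec.ret ⟨[g - Function.curry δ], .cons (fun p => ?_) .nil, ?_⟩).mono (by simp)
          fun _ _ _ h => h
      · exact hw p
      · intro w
        simp only [List.mem_singleton]
        exact ⟨fun hw => ⟨hw, hw ▸ h⟩, fun hw => hw.1⟩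
    · refine (Spec.ret ⟨[], .nil, fun w => ?_⟩).mono (by simp) fun _ _ _ h => h
      simp only [List.not_mem_nil, false_iff, not_and]
      rintro rfl
      exact h

/-- One round of pruning and verification for each sequence of draws; the outputs are collected. -/
noncomputable def decodeRuns [NeZero N] (s : ℕ) (η : ℝ) (z : ℕ) (a : AddrWord m N)
    (l : List (Fin N × Fin m → ℕ)) (d : Fin N × Fin m → ℕ) :
    List (List (Fin Q)) → Prog (List (AddrWord m N))
  | [] => ret []
  | ω :: ωs => (prune s z ω l d).andThen fun d' => (verify η z a d').andThen fun o =>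
      (decodeRuns s η z a l d ωs).andThen fun os => ret (o ++ os)

lemma Spec.decodeRuns [NeZero N] {s : ℕ} {η : ℝ} {z : ℕ} (hs : 1 ≤ s) (hm : 1 ≤ m) {σ : List F}
    {a : AddrWord m N} {l : List (Fin N × Fin m → ℕ)}
    {d : Fin N × Fin m → ℕ} {xs : List (Fin N × Fin m → F)} {δ : Fin N × Fin m → F}
    {g : FWord F m N} {code : Set (FWord F m N)} {ωs : List (List (Fin Q))}
    (hz : σ[z]? = some 0) (ha : RepWord σ a g)
    (hl : List.Forall₂ (RepVec σ) l xs) (hd : RepVec σ d δ)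
    (hxs : Module.finrank F (listSpan xs) = xs.length) (hle : xs.length ≤ s)
    (hcode : ∀ ε, ε - δ ∈ listSpan xs → g - Function.curry ε ∈ code)
    (hlist : ∀ w ∈ code, relDist g w < η → Function.uncurry (g - w) - δ ∈ listSpan xs)
    (hω : ∀ ω ∈ ωs, ω.length = s) :
    (Prog.decodeRuns s η z a l d ωs).Spec σ (ωs.length * (10 * s ^ 3 * (m * N))) fun r σ' =>
      ∃ ws, List.Forall₂ (RepWord σ') r ws ∧ (∀ w ∈ ws, w ∈ code ∧ relDist g w < η) ∧
        ∀ w ∈ code, relDist g w < η →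
          (∃ ω ∈ ωs, Isolates s (Function.uncurry (g - w)) ω (listSpan xs)) → w ∈ ws := by
  induction ωs generalizing σ with
  | nil => exact (Spec.ret ⟨[], .nil, by simp, by simp⟩).mono (by simp) fun _ _ _ h => h
  | cons ω ωs ih =>
    refine ((Spec.prune hs hm ω hz hl hd hxs hle).andThen
      (c₂ := 2 * (m * N) + ωs.length * (10 * s ^ 3 * (m * N))) fun d' σ₁ h₁ hd' => ?_).mono ?_
        fun _ _ _ h => h
    · obtain ⟨δ', hd', hmem, hiso⟩ := hd'
      refine (Spec.verify (h₁.getElem?_eq_some hz) (ha.mono h₁) hd').andThen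
        fun o σ₂ h₂ ho => ?_
      have h₁₂ := h₁.trans h₂
      refine ((ih (h₁₂.getElem?_eq_some hz) (ha.mono h₁₂) (hl.imp fun _ _ h => h.mono h₁₂)
        (hd.mono h₁₂) fun ω' hω' => hω ω' (by simp [hω'])).andThen (c₂ := 0)
        fun os σ₃ h₃ hos => Spec.ret ?_).mono (by omega) fun _ _ _ h => h
      obtain ⟨ws, hws, hmemws⟩ := ho
      obtain ⟨ws', hws', hsub, hall⟩ := hos
      refine ⟨ws ++ ws', List.rel_append (hws.imp fun _ _ h => h.mono h₃) hws', ?_, ?_⟩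
      · intro w hw
        rcases List.mem_append.1 hw with hw | hw
        · obtain ⟨rfl, hη⟩ := (hmemws w).1 hw
          exact ⟨hcode δ' hmem, hη⟩
        · exact hsub w hw
      · rintro w hwc hη ⟨ω', hω', hI⟩
        rcases List.mem_cons.1 hω' with rfl | hω'
        · refine List.mem_append_left _ ((hmemws w).2 ⟨?_, hη⟩)
          rw [hiso _ (hlist w hwc hη) hI, Function.curry_uncurry, sub_sub_cancel]
        · exact List.mem_append_right _ (hall w hwc hη ⟨ω', hω', hI⟩)
    · rw [hω ω (by simp), List.length_cons]
      have h1 : 2 * (m * N) ≤ 2 * s ^ 3 * (m * N) :=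
        Nat.mul_le_mul_right _ (by have := Nat.one_le_pow 3 s hs; omega)
      have h2 : s * (8 * s ^ 2 * (m * N)) = 8 * s ^ 3 * (m * N) := by ring
      have h3 : (ωs.length + 1) * (10 * s ^ 3 * (m * N)) = ωs.length * (10 * s ^ 3 * (m * N)) +
        (8 * s ^ 3 * (m * N) + 2 * s ^ 3 * (m * N)) := by ring
      omega

/-- The deterministic part of the decoder, given the draws `ωs` and the output `b` of an algorithm
that left a tape of length `n`. -/
noncomputable def decodeFrom [NeZero N] (s : ℕ) (η : ℝ) (ωs : List (List (Fin Q)))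
    (b : BasisOutput m N) (n : ℕ) : Prog (List (AddrWord m N)) :=
  (arith .sub 0 0).andThen fun z =>
    (tabulate fun p : Fin N × Fin m => arith .sub (Function.uncurry (inputAddr m N) p)
      (redirectAddr n z (b.origin p.1 p.2))).andThen fun d =>
    decodeRuns s η z (inputAddr m N)
      (List.ofFn fun i (p : Fin N × Fin m) => redirectAddr n z (b.dir i p.1 p.2)) d ωs

end Prog

/-! ### Affine subspaces of the code -/

section Affine

variable {F : Type*} [Field F] {m N : ℕ}

lemma mem_affineSet_iff {e : ℕ} {h₀ : FWord F m N} {h : Fin e → FWord F m N} {w : FWord F m N} :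
    w ∈ affineSet h₀ h ↔
      Function.uncurry (w - h₀) ∈ listSpan (List.ofFn fun i => Function.uncurry (h i)) := by
  have hset : {x | x ∈ List.ofFn fun i => Function.uncurry (h i)} =
      Set.range fun i => Function.uncurry (h i) := by
    ext x; simp
  rw [listSpan, hset, Submodule.mem_span_range_iff_exists_fun]
  refine exists_congr fun c => ?_
  rw [← sub_eq_iff_eq_add', ← (LinearEquiv.curry F F (Fin N) (Fin m)).injective.eq_iff, map_sum]
  simp only [map_smul]
  exact eq_comm

lemma finrank_listSpan_uncurry {e : ℕ} {h : Fin e → FWord F m N} (hh : LinearIndependent F h) :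
    Module.finrank F (listSpan (List.ofFn fun i => Function.uncurry (h i))) = e := by
  have hset : {x | x ∈ List.ofFn fun i => Function.uncurry (h i)} =
      Set.range fun i => Function.uncurry (h i) := by
    ext x; simp
  have hlin : LinearIndependent F fun i => Function.uncurry (h i) :=
    hh.map' (LinearEquiv.curry F F (Fin N) (Fin m)).symm.toLinearMap (LinearEquiv.ker _)
  rw [listSpan, hset, finrank_span_eq_card hlin, Fintype.card_fin]

lemma isFoldedEval_of_affineSet_subset {e k : ℕ} {γ : F} {h₀ : FWord F m N}
    {h : Fin e → FWord F m N} (hsub : affineSet h₀ h ⊆ frsCode m N k γ) :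
    IsFoldedEval k γ (listSpan (List.ofFn fun i => Function.uncurry (h i))) := by
  intro v hv
  obtain ⟨f₀, hf₀, he₀⟩ := hsub ((mem_affineSet_iff (w := h₀)).2 (by
    rw [sub_self]; exact Submodule.zero_mem _))
  obtain ⟨f, hf, he⟩ := hsub ((mem_affineSet_iff (w := h₀ + Function.curry v)).2 (by
    rwa [add_sub_cancel_left, Function.uncurry_curry]))
  refine ⟨f - f₀, (Polynomial.degree_sub_le _ _).trans_lt (max_lt hf hf₀), fun i j => ?_⟩
  have h1 := congrFun (congrFun he i) j
  have h2 := congrFun (congrFun he₀ i) j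
  simp only [frsEncode, Pi.add_apply, Function.curry] at h1 h2
  rw [Polynomial.eval_sub, h1, h2, add_sub_cancel_left]

end Affine

/-! ### Correctness and cost of the decoder -/

/-- The decoding radius in terms of the number of blocks of agreement, with `κ = m - s + 1`. -/
lemma lt_card_agree_of_relDist_lt {F : Type*} [Field F] [DecidableEq F] {m N k s κ : ℕ}
    (hN : 0 < N) (hκ : 0 < κ) (hm : κ + s = m + 1) (hm0 : 0 < m) {g w : FWord F m N}
    (h : relDist g w < frsRadius m N k s) :
    κ * N + s * k < (s + 1) * κ *
      (Finset.univ.filter fun i : Fin N => blockMap F i (Function.uncurry (g - w)) = 0).card := by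
  have hsplit : (Finset.univ.filter fun i : Fin N =>
      blockMap F i (Function.uncurry (g - w)) = 0).card + hammingDist g w = N := by
    have := Finset.card_filter_add_card_filter_not (s := (Finset.univ : Finset (Fin N)))
      (fun i => g i = w i)
    rw [Finset.card_univ, Fintype.card_fin] at this
    refine Eq.trans ?_ this
    unfold hammingDist
    congr 2
    ext i
    simp only [Finset.mem_filter, Finset.mem_univ, true_and]
    exact sub_eq_zero (a := g i) (b := w i)
  set a := (Finset.univ.filter fun i : Fin N =>
    blockMap F i (Function.uncurry (g - w)) = 0).card
  have hN' : (0 : ℝ) < N := by exact_mod_cast hN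
  have hm' : (0 : ℝ) < m := by exact_mod_cast hm0
  have hκ' : (0 : ℝ) < κ := by exact_mod_cast hκ
  have hmκ : (m : ℝ) - s + 1 = κ := by
    have : (κ : ℝ) + s = m + 1 := by exact_mod_cast hm
    linarith
  have hd : (hammingDist g w : ℝ) = N - a := by
    have : (a : ℝ) + hammingDist g w = N := by exact_mod_cast hsplit
    linarith
  rw [relDist, frsRadius, frsRate, hmκ, hd, div_lt_iff₀ hN'] at h
  have h2 : (s : ℝ) / (s + 1) * (1 - m * (k / (m * N)) / κ) * N * ((s + 1) * κ) =
      s * (κ * N - k) := by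
    field_simp
  have h3 := mul_lt_mul_of_pos_right h (show (0 : ℝ) < (s + 1) * κ by positivity)
  rw [h2] at h3
  have h4 : (κ * N + s * k : ℝ) < (s + 1) * κ * a := by nlinarith
  exact_mod_cast h4

lemma frsList_eq_empty {F : Type*} [Field F] [DecidableEq F] {m N k s κ : ℕ} {γ : F}
    (hN : 0 < N) (hκ : 0 < κ) (hm : κ + s = m + 1) (hm0 : 0 < m) (hk : κ * N ≤ k)
    (g : FWord F m N) : frsList k γ g (frsRadius m N k s) = ∅ := by
  rw [Set.eq_empty_iff_forall_notMem]
  rintro w ⟨-, hw⟩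
  have h1 := lt_card_agree_of_relDist_lt hN hκ hm hm0 hw
  have h2 := Finset.card_le_univ
    (Finset.univ.filter fun i : Fin N => blockMap F i (Function.uncurry (g - w)) = 0)
  rw [Fintype.card_fin] at h2
  have h3 := Nat.mul_le_mul_left ((s + 1) * κ) h2
  nlinarith

namespace Prog

variable {F : Type*} [Field F] [DecidableEq F] {N m Q : ℕ}

lemma Spec.decodeFrom [NeZero N] {k s : ℕ} (hs : 1 ≤ s) (hm : 1 ≤ m) {γ : F} {σ : List F}
    {g : FWord F m N} {b : BasisOutput m N} (hb : IsListBasis k s γ g b σ)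
    (hσ : inputTape γ g <+: σ) {ωs : List (List (Fin Q))} (hω : ∀ ω ∈ ωs, ω.length = s) :
    (Prog.decodeFrom s (frsRadius m N k s) ωs b σ.length).Spec σ
      (1 + m * N + ωs.length * (10 * s ^ 3 * (m * N))) fun r σ' =>
      (∀ w ∈ frsList k γ g (frsRadius m N k s), ∃ ω ∈ ωs, Isolates s (Function.uncurry (g - w)) ω
        (listSpan (List.ofFn fun i => Function.uncurry ((b.dir i).read σ)))) →
      outputSet (r, σ') = frsList k γ g (frsRadius m N k s) := by
  obtain ⟨hdim, hlin, hsub, hlist⟩ := hb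
  have hone : σ[0]? = some 1 := hσ.getElem?_eq_some (by simp [inputTape])
  have hg : RepWord σ (inputAddr m N) g := (repWord_inputTape γ g).mono hσ
  set xs := List.ofFn fun i => Function.uncurry ((b.dir i).read σ) with hxs
  set h₀ := b.origin.read σ
  refine ((Spec.arith hone hone).andThen
    (c₂ := m * N + ωs.length * (10 * s ^ 3 * (m * N))) fun z σ₁ h₁ hz => ?_).mono (by omega)
      fun _ _ _ h => h
  rw [show ArithOp.sub.eval (1 : F) 1 = 0 by simp [ArithOp.eval]] at hz
  refine ((Spec.tabulate (ι := Fin N × Fin m) (Q := fun p a σ' => σ'[a]? =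
    some (Function.uncurry (g - h₀) p)) (fun j a σ₁ σ₂ h ha => h.getElem?_eq_some ha)
    fun p σ₂ h₂ => Spec.arith ((hg.mono (h₁.trans h₂)) p)
      (repVec_redirectAddr (h₁.trans h₂) (h₂.getElem?_eq_some hz) b.origin p)).andThen
      (c₂ := ωs.length * (10 * s ^ 3 * (m * N))) fun d σ₂ h₂ hd => ?_).mono
      (by simp [mul_comm]) fun _ _ _ h => h
  have hl : List.Forall₂ (RepVec σ₂) (List.ofFn fun i (p : Fin N × Fin m) =>
      redirectAddr σ.length z (b.dir i p.1 p.2)) xs := by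
    rw [List.forall₂_iff_get]
    refine ⟨by simp [hxs], fun i hi hi' => ?_⟩
    simp only [hxs, List.get_eq_getElem, List.getElem_ofFn]
    exact repVec_redirectAddr (h₁.trans h₂) (h₂.getElem?_eq_some hz) _
  have hlen : xs.length = b.dim := by simp [hxs]
  have hmem : ∀ w, w ∈ affineSet h₀ (fun i => (b.dir i).read σ) ↔
      Function.uncurry (g - w) - Function.uncurry (g - h₀) ∈ listSpan xs := fun w => by
    rw [mem_affineSet_iff, ← Submodule.neg_mem_iff]
    have : -Function.uncurry (w - h₀) =
        Function.uncurry (g - w) - Function.uncurry (g - h₀) := by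
      funext p
      simp only [Function.uncurry, Pi.neg_apply, Pi.sub_apply]
      ring
    rw [this]
  refine (Spec.decodeRuns (code := frsCode m N k γ) hs hm (h₂.getElem?_eq_some hz)
    (hg.mono (h₁.trans h₂)) hl hd
    (by rw [hlen]; exact finrank_listSpan_uncurry hlin) (by omega) ?_ ?_ hω).mono le_rfl ?_
  · intro ε hε
    refine hsub ((hmem _).2 ?_)
    rwa [sub_sub_cancel, Function.uncurry_curry]
  · exact fun w hw hη => (hmem w).1 (hlist ⟨hw, hη⟩)
  · rintro r σ' - ⟨ws, hws, hin, hall⟩ hcov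
    rw [outputSet_eq_of_forall₂ hws]
    exact Set.Subset.antisymm hin fun w hw => hall w hw.1 hw.2 (hcov w hw)

end Prog

/-- The draws for `t` rounds of `s` pinnings each. -/
abbrev PruneSeeds (t s Q : ℕ) : Type := Fin t → Fin s → Fin Q

lemma exists_covering_seeds {F : Type*} [Field F] [Fintype F] [DecidableEq F] {N m k s κ Q : ℕ}
    [NeZero N] (hs : 1 ≤ s) {γ : F} (hκ : 0 < κ)
    (hm : κ + s = m + 1) (hk : k < κ * N) (hkn : k ≤ m * N) (hγ : m * N ≤ orderOf γ) [NeZero Q]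
    (hQ : ∀ W, 0 < W → W ≤ N * (s * s + 1) → W ∣ Q)
    {σ : List F} {g : FWord F m N} {b : BasisOutput m N} (hb : IsListBasis k s γ g b σ) (t : ℕ) :
    ∃ G : Finset (PruneSeeds t s Q),
      (1 - (s ^ 2 : ℕ) * Real.exp (-(t / (s ^ 2 : ℕ)))) * Fintype.card (PruneSeeds t s Q) ≤ G.card ∧
      ∀ ζ ∈ G, ∀ w ∈ frsList k γ g (frsRadius m N k s), ∃ j,
        Isolates s (Function.uncurry (g - w)) (List.ofFn (ζ j))
          (listSpan (List.ofFn fun i => Function.uncurry ((b.dir i).read σ))) := by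
  classical
  obtain ⟨hdim, hlin, hsub, hlist⟩ := hb
  set V := listSpan (List.ofFn fun i => Function.uncurry ((b.dir i).read σ))
  have hV : Module.finrank F V = b.dim := finrank_listSpan_uncurry hlin
  let L : Finset (FWord F m N) := (Set.toFinite (frsList k γ g (frsRadius m N k s))).toFinset
  have hL : ∀ w, w ∈ L ↔ w ∈ frsList k γ g (frsRadius m N k s) := fun w => by simp [L]
  have hiso : ∀ w ∈ L, Fintype.card (Fin s → Fin Q) ≤
      (isolatingSeeds s s Q (Function.uncurry (g - w)) V).card * s ^ 2 := by
    intro w hw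
    have h1 := pow_le_card_isolatingSeeds hκ hm hk hkn hγ hQ (Function.uncurry (g - w))
      (lt_card_agree_of_relDist_lt (Nat.pos_of_neZero N) hκ hm (by omega) ((hL w).1 hw).2)
      s V (isFoldedEval_of_affineSet_subset hsub) (by omega) (by omega)
    rw [Fintype.card_fun, Fintype.card_fin, Fintype.card_fin]
    refine h1.trans (Nat.mul_le_mul_left _ ?_)
    rw [hV]
    obtain ⟨s, rfl⟩ := Nat.exists_eq_add_of_le' hs
    have : b.dim ≤ s := by omega
    nlinarith
  have hdisj : (L : Set (FWord F m N)).PairwiseDisjoint fun w =>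
      isolatingSeeds s s Q (Function.uncurry (g - w)) V := by
    intro w hw w' hw' hne
    rw [Function.onFun, Finset.disjoint_left]
    intro ω h h'
    refine hne ?_
    have h1 : w ∈ affineSet _ _ := hlist ((hL w).1 hw)
    have h2 : w' ∈ affineSet _ _ := hlist ((hL w').1 hw')
    rw [mem_affineSet_iff] at h1 h2
    have h3 := Isolates.unique (Finset.mem_filter.1 h).2 (Finset.mem_filter.1 h').2 (by
      convert Submodule.sub_mem _ h2 h1 using 1
      funext p
      simp only [Function.uncurry, Pi.sub_apply]
      ring)
    funext i j
    have := congrFun h3 (i, j)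
    simpa [Function.uncurry] using this
  obtain ⟨G, hG, hcov⟩ := exists_covering_finset L _ t (by positivity) hiso hdisj
  refine ⟨G, hG, fun ζ hζ w hw => ?_⟩
  obtain ⟨j, hj⟩ := hcov ζ hζ w ((hL w).2 hw)
  exact ⟨j, (Finset.mem_filter.1 hj).2⟩

/-- Cost and probability of success of an algorithm followed by a randomized continuation. -/
lemma worstOps_bind_le_and_le_run_bind {α β : Type} {F : Type*} [Field F] [DecidableEq F]
    {m N : ℕ} {γ : F}
    {g : FWord F m N} {A : CompTree α} {f : α → ℕ → CompTree β} {c₁ c₂ : ℕ} {q : ENNReal}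
    {E : Set (β × List F)} {I : α × List F → Prop}
    (h₁ : A.worstOps (inputTape γ g) ≤ c₁)
    (hI : ∀ o ∈ (A.run (inputTape γ g)).support, I o)
    (h₂ : ∀ o, I o → inputTape γ g <+: o.2 → (f o.1 o.2.length).worstOps o.2 ≤ c₂ ∧
      q ≤ ((f o.1 o.2.length).run o.2).toOuterMeasure E) :
    (A.bind f (2 + m * N)).worstOps (inputTape γ g) ≤ c₁ + c₂ ∧
      q ≤ ((A.bind f (2 + m * N)).run (inputTape γ g)).toOuterMeasure E := by
  rw [← length_inputTape γ g]
  have h : ∀ o ∈ (A.run (inputTape γ g)).support, _ := fun o ho =>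
    h₂ o (hI o ho) (CompTree.isPrefix_of_mem_support_run _ _ o ho)
  refine ⟨CompTree.worstOps_bind_le _ _ _ h₁ fun o ho => (h o ho).1, ?_⟩
  rw [CompTree.run_bind]
  exact le_toOuterMeasure_bind fun o ho => (h o ho).2

/-- The number of rounds is `⌈s ^ 2 * log (s ^ 2 / β)⌉`. The excluded range `s = 1`, `β > 1 / 2` is
the one in which `log (s / β)` can be too small to pay for a single round. -/
lemma exists_rounds {s : ℕ} {β : ℝ} (hs : 1 ≤ s) (hβ : 0 < β) (hβ1 : β < 1)
    (h : s = 1 → β ≤ 1 / 2) :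
    ∃ t : ℕ, (s ^ 2 : ℕ) * Real.exp (-(t / (s ^ 2 : ℕ))) ≤ β ∧
      (t : ℝ) ≤ 4 * s ^ 2 * Real.log (s / β) ∧ 1 ≤ 2 * Real.log (s / β) := by
  have hs' : (1 : ℝ) ≤ s := by exact_mod_cast hs
  have h2 : 2 ≤ s / β := by
    rw [le_div_iff₀ hβ]
    rcases hs.eq_or_lt with h1 | h1
    · have := h h1.symm
      linarith
    · have : (2 : ℝ) ≤ s := by exact_mod_cast h1
      linarith
  have hlog : 1 ≤ 2 * Real.log (s / β) := by
    have h3 := Real.log_le_log (by norm_num) h2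
    have h4 := Real.log_two_gt_d9
    linarith
  have hpos : (0 : ℝ) < s ^ 2 := by positivity
  refine ⟨⌈(s : ℝ) ^ 2 * Real.log (s ^ 2 / β)⌉₊, ?_, ?_, hlog⟩
  · push_cast
    have h3 : Real.log (s ^ 2 / β) ≤
        (⌈(s : ℝ) ^ 2 * Real.log (s ^ 2 / β)⌉₊ : ℝ) / s ^ 2 := by
      rw [le_div_iff₀ hpos, mul_comm]
      exact Nat.le_ceil _
    calc (s : ℝ) ^ 2 * Real.exp (-((⌈(s : ℝ) ^ 2 * Real.log (s ^ 2 / β)⌉₊ : ℝ) / s ^ 2))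
        ≤ s ^ 2 * Real.exp (-Real.log (s ^ 2 / β)) := by gcongr
      _ = β := by
        rw [Real.exp_neg, Real.exp_log (by positivity)]
        field_simp
  · have h4 : Real.log (s ^ 2 / β) ≤ 2 * Real.log (s / β) := by
      have : Real.log ((s / β) ^ 2) = 2 * Real.log (s / β) := by simp [Real.log_pow]
      rw [← this]
      refine Real.log_le_log (by positivity) ?_
      rw [div_pow]
      gcongr
      nlinarith
    have h5 : 0 ≤ Real.log (s ^ 2 / β) := Real.log_nonneg (by
      rw [le_div_iff₀ hβ]; nlinarith)
    have h6 := (Nat.ceil_lt_add_one (mul_nonneg hpos.le h5)).le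
    have h7 := mul_le_mul_of_nonneg_left h4 hpos.le
    have h8 : 1 ≤ (s : ℝ) ^ 2 * (2 * Real.log (s / β)) := by nlinarith
    linarith

theorem theorem4p3 :
    ∃ C : ℝ, 0 < C ∧
      ∀ (m N k s : ℕ) (β : ℝ), 0 < N → k ≤ m * N → 1 ≤ s → s ≤ m → 0 < β → β ≤ (s : ℝ) →
      ∀ A : CompTree (BasisOutput m N), ∃ P : CompTree (List (AddrWord m N)),
      ∀ (F : Type*) [Field F] [Fintype F] [DecidableEq F] (γ : F),
        m * N < Fintype.card F → m * N ≤ orderOf γ →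
        ∀ T : ℕ, ComputesListBasis k s γ A T →
        ∀ g : FWord F m N,
          (P.worstOps (inputTape γ g) : ℝ) ≤
            (T : ℝ) + C * ((m : ℝ) * (s : ℝ) ^ 5 * Real.log ((s : ℝ) / β) * (N : ℝ)) ∧
          ENNReal.ofReal (1 - β) ≤
            (P.run (inputTape γ g)).toOuterMeasure
              {o | outputSet o = frsList k γ g (frsRadius m N k s)} := by
  refine ⟨48, by norm_num, fun m N k s β hN hk hs hsm hβ hβs A => ?_⟩
  have hlog0 : 0 ≤ Real.log ((s : ℝ) / β) := Real.log_nonneg (by rwa [le_div_iff₀ hβ, one_mul])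
  have hcost0 : 0 ≤ 48 * ((m : ℝ) * (s : ℝ) ^ 5 * Real.log ((s : ℝ) / β) * (N : ℝ)) := by
    positivity
  have hm1 : 1 ≤ m := hs.trans hsm
  obtain ⟨κ, hκ⟩ : ∃ κ, κ + s = m + 1 := ⟨m + 1 - s, by omega⟩
  have hκ0 : 0 < κ := by omega
  -- For `1 ≤ β` nothing is claimed about the probability of success.
  by_cases hβ1 : 1 ≤ β
  · refine ⟨.halt [], fun F _ _ _ γ _ _ T _ g => ⟨?_, ?_⟩⟩
    · simp only [CompTree.worstOps, Nat.cast_zero]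
      positivity
    · rw [ENNReal.ofReal_of_nonpos (by linarith)]
      exact zero_le
  push Not at hβ1
  -- The decoding radius is not positive, so the list is empty.
  by_cases hkκ : κ * N ≤ k
  · refine ⟨.halt [], fun F _ _ _ γ _ _ T _ g => ⟨?_, ?_⟩⟩
    · simp only [CompTree.worstOps, Nat.cast_zero]
      positivity
    · rw [(PMF.toOuterMeasure_apply_eq_one_iff _ _).2]
      · exact ENNReal.ofReal_le_one.2 (by linarith)
      · rintro o ho
        simp only [CompTree.run, PMF.support_pure, Set.mem_singleton_iff] at ho
        subst ho
        change outputSet _ = _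
        rw [frsList_eq_empty hN hκ0 hκ hm1 hkκ, outputSet_eq_of_forall₂ .nil]
        simp
  push Not at hkκ
  -- Here the budget may not allow a single operation beyond those of `A`, but the list is either
  -- empty or the single word that `A` finds, and guessing which is right with probability `1 / 2`.
  by_cases hcoin : s = 1 ∧ 1 / 2 < β
  · obtain ⟨rfl, hβ2⟩ := hcoin
    refine ⟨A.bind (fun b _ => CompTree.drawThen Bool fun c =>
      .halt (if c then [b.origin] else [])) (2 + m * N), fun F _ _ _ γ _ _ T hA g => ?_⟩
    have := worstOps_bind_le_and_le_run_bind (c₂ := 0) (q := ENNReal.ofReal (1 - β))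
      (E := {o | outputSet o = frsList k γ g (frsRadius m N k 1)})
      (I := fun o => IsListBasis k 1 γ g o.1 o.2) (hA g).1 (hA g).2
      (f := fun b _ => CompTree.drawThen Bool fun c => .halt (if c then [b.origin] else []))
      fun o ho _ => ⟨CompTree.worstOps_drawThen_le fun x => le_rfl, ?_⟩
    · refine ⟨?_, this.2⟩
      have h1 : ((A.bind (fun b _ => CompTree.drawThen Bool fun c =>
        .halt (if c then [b.origin] else [])) (2 + m * N)).worstOps (inputTape γ g) : ℝ) ≤ T := by
        exact_mod_cast this.1
      linarith
    · obtain ⟨hdim, -, -, hlist⟩ := ho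
      have hsing : ∀ w ∈ frsList k γ g (frsRadius m N k 1), w = o.1.origin.read o.2 := by
        intro w hw
        obtain ⟨c, hc⟩ := hlist hw
        have : IsEmpty (Fin o.1.dim) := ⟨fun i => absurd i.2 (by have : o.1.dim + 1 ≤ 1 := hdim; omega)⟩
        simpa using hc
      have hout : ∃ c : Bool, outputSet ((if c then [o.1.origin] else []), o.2) =
          frsList k γ g (frsRadius m N k 1) := by
        by_cases hne : (frsList k γ g (frsRadius m N k 1)).Nonempty
        · obtain ⟨w, hw⟩ := hne
          refine ⟨true, ?_⟩
          ext v
          simp only [outputSet, if_true, List.mem_singleton, exists_eq_left]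
          exact ⟨fun h => by rw [← (show _ = v from h), ← hsing w hw]; exact hw,
            fun h => (hsing v h).symm⟩
        · refine ⟨false, ?_⟩
          rw [Set.not_nonempty_iff_eq_empty.1 hne]
          simp [outputSet]
      obtain ⟨c, hc⟩ := hout
      refine le_trans ?_ (CompTree.card_div_card_le_run_drawThen {c} fun x hx o' ho' => ?_)
      · rw [Finset.card_singleton, Fintype.card_bool, Nat.cast_one]
        refine ENNReal.ofReal_le_of_le_toReal ?_
        simp only [Nat.cast_ofNat, one_div, ENNReal.toReal_inv, ENNReal.toReal_ofNat]
        linarith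
      · rw [Finset.mem_singleton.1 hx] at ho'
        simp only [CompTree.run, PMF.support_pure, Set.mem_singleton_iff] at ho'
        rw [ho']
        exact hc
  have hcoin' : s = 1 → β ≤ 1 / 2 := fun h => not_lt.1 fun h' => hcoin ⟨h, h'⟩
  obtain ⟨t, ht, htle, hlog1⟩ := exists_rounds hs hβ hβ1 hcoin'
  have : NeZero N := ⟨hN.ne'⟩
  -- Every total weight that can occur divides `Q`.
  let Q := (N * (s * s + 1)).factorial
  have hQ0 : NeZero Q := ⟨Nat.factorial_ne_zero _⟩
  have hQ : ∀ W, 0 < W → W ≤ N * (s * s + 1) → W ∣ Q := fun W h h' => Nat.dvd_factorial h h'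
  let f : BasisOutput m N → ℕ → CompTree (List (AddrWord m N)) := fun b n =>
    CompTree.drawThen (PruneSeeds t s Q) fun ζ =>
      Prog.decodeFrom s (frsRadius m N k s) (List.ofFn fun j => List.ofFn (ζ j)) b n n
  refine ⟨A.bind f (2 + m * N), fun F _ _ _ γ _ hγ T hA g => ?_⟩
  have main := worstOps_bind_le_and_le_run_bind (c₂ := 1 + m * N + t * (10 * s ^ 3 * (m * N)))
    (q := ENNReal.ofReal (1 - β))
    (E := {o | outputSet o = frsList k γ g (frsRadius m N k s)})
    (I := fun o => IsListBasis k s γ g o.1 o.2) (hA g).1 (hA g).2 (f := f)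
    fun o ho hpre => ?_
  · refine ⟨?_, main.2⟩
    have h1 : ((A.bind f (2 + m * N)).worstOps (inputTape γ g) : ℝ) ≤
        T + (1 + m * N + t * (10 * s ^ 3 * (m * N))) := by exact_mod_cast main.1
    refine h1.trans (add_le_add le_rfl ?_)
    set ℓ := Real.log ((s : ℝ) / β)
    have hs' : (1 : ℝ) ≤ s := by exact_mod_cast hs
    have hmN : (1 : ℝ) ≤ m * N := by exact_mod_cast Nat.mul_pos hm1 hN
    have h2 : (t : ℝ) * (10 * s ^ 3 * (m * N)) ≤ 4 * s ^ 2 * ℓ * (10 * s ^ 3 * (m * N)) :=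
      mul_le_mul_of_nonneg_right htle (by positivity)
    have h3 : (1 + m * N : ℝ) ≤ 4 * ℓ * (s ^ 5 * (m * N)) := by
      have h4 : (1 : ℝ) ≤ s ^ 5 := one_le_pow₀ hs'
      have h5 : (m * N : ℝ) ≤ s ^ 5 * (m * N) := le_mul_of_one_le_left (by positivity) h4
      nlinarith
    have h6 : 0 ≤ ℓ * (s ^ 5 * (m * N)) := by positivity
    nlinarith
  · have hspec : ∀ ζ : PruneSeeds t s Q, _ := fun ζ =>
      Prog.Spec.decodeFrom hs hm1 ho hpre (ωs := List.ofFn fun j => List.ofFn (ζ j)) (by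
        intro ω hω
        obtain ⟨j, rfl⟩ := List.mem_ofFn.1 hω
        simp)
    refine ⟨CompTree.worstOps_drawThen_le fun ζ => ?_, ?_⟩
    · have := (hspec ζ).1
      rwa [List.length_ofFn] at this
    · obtain ⟨G, hG, hcov⟩ := exists_covering_seeds hs hκ0 hκ hkκ hk hγ hQ ho t
      refine le_trans ?_ (CompTree.card_div_card_le_run_drawThen G fun ζ hζ o' ho' => ?_)
      · have hX : (0 : ℝ) < Fintype.card (PruneSeeds t s Q) := by
          exact_mod_cast Fintype.card_pos
        refine ENNReal.ofReal_le_of_le_toReal ?_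
        rw [ENNReal.toReal_div, ENNReal.toReal_natCast, ENNReal.toReal_natCast,
          le_div_iff₀ hX]
        refine le_trans (mul_le_mul_of_nonneg_right ?_ hX.le) hG
        linarith
      · refine (hspec ζ).2 o' ho' fun w hw => ?_
        obtain ⟨j, hj⟩ := hcov ζ hζ w hw
        exact ⟨_, List.mem_ofFn.2 ⟨j, rfl⟩, hj⟩
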